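/- Write $h^g=g^{-1}hg$ and $[g,h]=g^{-1}h^{-1}gh$. For a group $G$ generated by two elements $a,b$ of the same order, let $A=\langle a\rangle$, $B=\langle b\rangle$, and let $\phi:B\to A$ be the isomorphism with $\phi(b)=a$. For $k\ge 1$ let $\overline{\mathrm{Hig}}_k(G)$ be the quotient of the free product of $k$ copies $G_1,\dots,G_k$ of $G$ obtained by identifying, for every $i$ (indices modulo $k$) and every $x\in B$, the copy of $x$ in $G_i$ with the copy of $\phi(x)$ in $G_{i+1}$. A group $\Gamma$ is *residually solvable* if for every $x\in\Gamma\smallsetminus\{1\}$ there is a surjective homomorphism $f$ from $\Gamma$ onto a solvable group with $f(x)\neq 1$. It is *sofic* if for every finite subset $S\subseteq\Gamma$ and every $\delta>0$ there are an integer $n\ge 1$ and a map $\psi:\Gamma\to\mathrm{Sym}(n)$ such that $d(\psi(g)\psi(h),\psi(gh))<\delta$ for all $g,h\in S$ with $gh\in S$, and $d(\psi(g),\mathrm{id})>1-\delta$ for all $g\in S\smallsetminus\{1\}$, where $d(\rho,\sigma)=\frac1n\,|\{i:\rho(i)\ne\sigma(i)\}|$. **Corollary.** Let $G$, with generators $a,b$,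 be any one of the following groups (in each of them $a$ and $b$ have infinite order): 1. $\mathbb Z^2=\langle a,b\mid ab=ba\rangle$; 2. the three-dimensional integral Heisenberg group $\langle a,b\mid [a,[a,b]]=[b,[a,b]]=1\rangle$; 3. $\mathbb Z\wr\mathbb Z=\langle a,b\mid [a^{b^i},a^{b^j}]=1 \text{ for all } i,j\in\mathbb Z\rangle$; 4. the free metabelian group on two generators $\langle a,b\mid [[a,b],[a,b]^{a^ib^j}]=1\text{ for all } i,j\in\mathbb Z\rangle$. Then for every $k\ge 4$ the group $\overline{\mathrm{Hig}}_k(G)$ is residually solvable, and hence sofic. -/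

import Mathlib

namespace HigmanVariations

section Sofic

/-- The normalized Hamming distance on `Sym(n)`. -/
noncomputable def hammingDistance {n : ℕ} (ρ σ : Equiv.Perm (Fin n)) : ℝ :=
  ((Finset.univ.filter fun i : Fin n => ρ i ≠ σ i).card : ℝ) / (n : ℝ)

/-- `ψ` is an `(S, δ, n)`-approximation of the group `G`. -/
def IsApproximation {G : Type*} [Group G] (S : Finset G) (δ : ℝ) (n : ℕ)
    (ψ : G → Equiv.Perm (Fin n)) : Prop :=
  (∀ g ∈ S, ∀ h ∈ S, g * h ∈ S → hammingDistance (ψ g * ψ h) (ψ (g * h)) < δ) ∧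
  (∀ g ∈ S, g ≠ 1 → 1 - δ < hammingDistance (ψ g) 1)

/-- A group is sofic when every finite subset is, to any accuracy, well approximated in a finite
symmetric group on a nonempty set. -/
def IsSofic (G : Type*) [Group G] : Prop :=
  ∀ (S : Finset G) (δ : ℝ), 0 < δ →
    ∃ n : ℕ, 0 < n ∧ ∃ ψ : G → Equiv.Perm (Fin n), IsApproximation S δ n ψ

end Sofic

/-- A group is residually solvable when every nontrivial element survives in some solvable
quotient. -/
def IsResiduallySolvable.{u} (G : Type u) [Group G] : Prop :=
  ∀ x : G, x ≠ 1 → ∃ (H : Type u) (_ : Group H) (f : G →* H),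
    Function.Surjective f ∧ Group.IsSolvable H ∧ f x ≠ 1

section HigBar

variable {G : Type*} [Group G] {A B : Subgroup G}

/-- In the free product of copies `G_i` of `G` indexed by `ℤ/k`, the relators
`b_i * φ_i(b_i)⁻¹`, where `φ_i : B_i → A_{i+1}` is the copy of `φ : B → A`. -/
def higBarRelators (k : ℕ) (φ : B ≃* A) : Set (Monoid.CoprodI fun _ : ZMod k => G) :=
  {r | ∃ (i : ZMod k) (b : B),
    r = Monoid.CoprodI.of (M := fun _ : ZMod k => G) (i := i) (b : G) *
      (Monoid.CoprodI.of (M := fun _ : ZMod k => G) (i := i + 1) (φ b : G))⁻¹}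

/-- `Hig-bar_k(G, φ)`: the free product of `k` copies of `G` (for `k ≥ 1`) in which, cyclically,
the subgroup `B` of each copy is identified through `φ` with the subgroup `A` of the next copy. -/
abbrev HigBar (k : ℕ) (φ : B ≃* A) : Type _ :=
  (Monoid.CoprodI fun _ : ZMod k => G) ⧸ Subgroup.normalClosure (higBarRelators k φ)

end HigBar

section Cyclic

variable {G : Type*} [Group G]

/-- The isomorphism `⟨b⟩ → ⟨a⟩` with `b ↦ a`, for elements `a`, `b` of the same order. -/
noncomputable def cyclicIso {a b : G} (h : orderOf a = orderOf b) :
    Subgroup.zpowers b ≃* Subgroup.zpowers a :=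
  mulEquivOfOrderOfEq
    (g := (⟨b, Subgroup.mem_zpowers b⟩ : Subgroup.zpowers b))
    (g' := (⟨a, Subgroup.mem_zpowers a⟩ : Subgroup.zpowers a))
    (by rintro ⟨_, n, rfl⟩; exact ⟨n, by ext; simp⟩)
    (by rintro ⟨_, n, rfl⟩; exact ⟨n, by ext; simp⟩)
    (by simpa using h.symm)

theorem cyclicIso_apply {a b : G} (h : orderOf a = orderOf b) :
    cyclicIso h ⟨b, Subgroup.mem_zpowers b⟩ = ⟨a, Subgroup.mem_zpowers a⟩ := by
  simp [cyclicIso]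

/-- `Hig-bar_k(G)` with respect to two elements `a`, `b` of the same order: here `A = ⟨a⟩`,
`B = ⟨b⟩` and `φ : b ↦ a`. -/
abbrev HigBarCyclic (k : ℕ) (a b : G) (h : orderOf a = orderOf b) : Type _ :=
  HigBar k (cyclicIso h)

end Cyclic

section Examples

/-- `g ^ h = h⁻¹ g h`. -/
def conjBy {G : Type*} [Group G] (g h : G) : G := h⁻¹ * g * h

/-- `[g, h] = g⁻¹ h⁻¹ g h`. -/
def commBy {G : Type*} [Group G] (g h : G) : G := g⁻¹ * h⁻¹ * g * h

/-- The free generator `a` of the free group on two letters. -/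
def letterA : FreeGroup (Fin 2) := FreeGroup.of 0

/-- The free generator `b` of the free group on two letters. -/
def letterB : FreeGroup (Fin 2) := FreeGroup.of 1

/-- The generator `a` of `⟨a, b | R⟩`. -/
def genA (R : Set (FreeGroup (Fin 2))) : PresentedGroup R := PresentedGroup.mk R letterA

/-- The generator `b` of `⟨a, b | R⟩`. -/
def genB (R : Set (FreeGroup (Fin 2))) : PresentedGroup R := PresentedGroup.mk R letterB

/-- `⟨a, b | ab = ba⟩`, the group `ℤ²`. -/
def zSquareRelators : Set (FreeGroup (Fin 2)) :=
  {(letterA * letterB) * (letterB * letterA)⁻¹}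

/-- `⟨a, b | [a, [a, b]] = [b, [a, b]] = 1⟩`, the three-dimensional integral Heisenberg group. -/
def heisenbergRelators : Set (FreeGroup (Fin 2)) :=
  {commBy letterA (commBy letterA letterB), commBy letterB (commBy letterA letterB)}

/-- `⟨a, b | [a ^ (b ^ i), a ^ (b ^ j)] = 1 for all i, j ∈ ℤ⟩`, the group `ℤ ≀ ℤ = ⟨a⟩ ≀ ⟨b⟩`. -/
def wreathRelators : Set (FreeGroup (Fin 2)) :=
  {r | ∃ i j : ℤ, r = commBy (conjBy letterA (letterB ^ i)) (conjBy letterA (letterB ^ j))}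

/-- `⟨a, b | [[a, b], [a, b] ^ (a ^ i b ^ j)] = 1 for all i, j ∈ ℤ⟩`, the free metabelian group
on two generators. -/
def metabelianRelators : Set (FreeGroup (Fin 2)) :=
  {r | ∃ i j : ℤ, r = commBy (commBy letterA letterB)
    (conjBy (commBy letterA letterB) (letterA ^ i * letterB ^ j))}

/-- If every relator has total exponent zero, then both generators have infinite order. -/
theorem orderOf_genA_eq_genB {R : Set (FreeGroup (Fin 2))}
    (hR : ∀ r ∈ R, FreeGroup.lift (fun _ : Fin 2 => Multiplicative.ofAdd (1 : ℤ)) r = 1) :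
    orderOf (genA R) = 0 ∧ orderOf (genB R) = 0 := by
  have key : ∀ x : PresentedGroup R,
      PresentedGroup.toGroup hR x = Multiplicative.ofAdd (1 : ℤ) → orderOf x = 0 := by
    intro x hx
    have h := orderOf_map_dvd (PresentedGroup.toGroup hR) x
    have h1 : orderOf (Multiplicative.ofAdd (1 : ℤ)) = 0 := by
      rw [orderOf_ofAdd_eq_addOrderOf, addOrderOf_eq_zero_iff']
      intro n hn
      simpa using hn.ne'
    rw [hx, h1] at h
    exact zero_dvd_iff.mp h
  exact ⟨key _ (PresentedGroup.toGroup.of hR), key _ (PresentedGroup.toGroup.of hR)⟩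

theorem orderOf_zSquare :
    orderOf (genA zSquareRelators) = orderOf (genB zSquareRelators) := by
  have h := orderOf_genA_eq_genB (R := zSquareRelators) (by
    rintro r rfl
    simp [letterA, letterB])
  rw [h.1, h.2]

theorem orderOf_heisenberg :
    orderOf (genA heisenbergRelators) = orderOf (genB heisenbergRelators) := by
  have h := orderOf_genA_eq_genB (R := heisenbergRelators) (by
    rintro r (rfl | rfl) <;> simp [letterA, letterB, commBy])
  rw [h.1, h.2]

theorem orderOf_wreath :
    orderOf (genA wreathRelators) = orderOf (genB wreathRelators) := by
  have h := orderOf_genA_eq_genB (R := wreathRelators) (by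
    rintro r ⟨i, j, rfl⟩
    simp [letterA, letterB, commBy, conjBy])
  rw [h.1, h.2]

theorem orderOf_metabelian :
    orderOf (genA metabelianRelators) = orderOf (genB metabelianRelators) := by
  have h := orderOf_genA_eq_genB (R := metabelianRelators) (by
    rintro r ⟨i, j, rfl⟩
    simp [letterA, letterB, commBy, conjBy])
  rw [h.1, h.2]

/-- `Hig-bar_k(ℤ²)`. -/
abbrev HigBarZSquare (k : ℕ) : Type :=
  HigBarCyclic k (genA zSquareRelators) (genB zSquareRelators) orderOf_zSquare

/-- `Hig-bar_k` of the integral Heisenberg group. -/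
abbrev HigBarHeisenberg (k : ℕ) : Type :=
  HigBarCyclic k (genA heisenbergRelators) (genB heisenbergRelators) orderOf_heisenberg

/-- `Hig-bar_k(ℤ ≀ ℤ)`. -/
abbrev HigBarWreath (k : ℕ) : Type :=
  HigBarCyclic k (genA wreathRelators) (genB wreathRelators) orderOf_wreath

/-- `Hig-bar_k` of the free metabelian group on two generators. -/
abbrev HigBarMetabelian (k : ℕ) : Type :=
  HigBarCyclic k (genA metabelianRelators) (genB metabelianRelators) orderOf_metabelian

end Examples

end HigmanVariations

namespace HigmanVariations

/-! For G = ⟨a, b | R⟩, the group in question has generators x_v for v in `ZMod k` and relators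
r(x_v, x_{v+1}) for r in R, since b in the i-th copy is a in the next. Each relator considered here
becomes trivial when either letter is killed. Hence, for every set S of indices, the generators in S
subject to the relators between them give a retract Γ_S of the whole group.

If u and v in S are distinct and not adjacent on the cycle, no relator involves both, so Γ_S is the
amalgam of Γ_{S∖u} and Γ_{S∖v} over their common retract Γ_{S∖{u,v}}. By induction on S everything
reduces to sets of pairwise adjacent indices. As k ≥ 4, these lie in some {u, u+1}, and then Γ_S is
a quotient of the solvable group G.

The induction rests on `isResiduallySolvable_amalgam`. Let m_1⋯m_n be an alternating product with no
m_j in the common retract H. Residual solvability gives compatible maps α_k of the factors to a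
solvable D with α(m_j) ≠ α(r(m_j)). So γ_k = (α_k, α_0∘r_k) maps H to the diagonal of D × D and each
m_j off it. In L ≀ (D × D), conjugate γ_k by a base function c(k, ·) that is constant on the cosets
of the diagonal; the twisted maps still agree on H. One base coordinate of the image of m_1⋯m_n is
then a word in the free values c(k, coset), with exponents ±1 and distinct neighbouring letters.
Such a word survives in a unitriangular group L under the assignment x ↦ 1 + N_x, where N_x² = 0.

Soficity follows because a finite set is separated in a single solvable quotient, and a solvable
group is built from its derived series by extensions with abelian quotient. Følner sets of that
quotient carry finite models of the kernel up to the whole group. -/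

/-! ### Words with distinct neighbouring letters in unitriangular matrices -/

/-- The matrix with an entry `1` at `(i, i + 1)` whenever the `i`-th letter of the word is `x`. -/
def letterShift {X : Type} [DecidableEq X] (l : List (X × Bool)) (x : X) :
    Matrix (Fin (l.length + 1)) (Fin (l.length + 1)) ℤ :=
  fun i j => if (i : ℕ) + 1 = j ∧ (l[(i : ℕ)]?).map Prod.fst = some x then 1 else 0

theorem letterShift_mulVec {X : Type} [DecidableEq X] (l : List (X × Bool)) (x : X)
    (v : Fin (l.length + 1) → ℤ) (i : ℕ) (hi : i < l.length) :
    (letterShift l x).mulVec v ⟨i, by omega⟩ =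
      if l[i].1 = x then v ⟨i + 1, by omega⟩ else 0 := by
  rw [Matrix.mulVec, dotProduct, Finset.sum_eq_single ⟨i + 1, by omega⟩]
  · simp [letterShift, hi]
  · intro j _ hj
    have : ¬ i + 1 = (j : ℕ) := fun h => hj (Fin.ext h.symm)
    simp [letterShift, this]
  · simp

/-- A nonzero term in the square would need the same letter at two consecutive positions.
Consequently 1 + N_x has inverse 1 - N_x, which treats the exponents ±1 alike. -/
theorem letterShift_mul_self {X : Type} [DecidableEq X] {l : List (X × Bool)}
    (hl : l.IsChain fun p q => p.1 ≠ q.1) (x : X) : letterShift l x * letterShift l x = 0 := by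
  ext i j
  rw [Matrix.mul_apply]
  refine Finset.sum_eq_zero fun s _ => ?_
  unfold letterShift
  split_ifs with h1 h2 <;> try simp
  obtain ⟨hs, h1⟩ := h1
  obtain ⟨hj, h2⟩ := h2
  rw [← hs] at h2 hj
  have hlt : (i : ℕ) + 1 < l.length := by omega
  have := List.isChain_iff_getElem.mp hl i hlt
  rw [List.getElem?_eq_getElem (by omega)] at h1 h2
  simp only [Option.map_some, Option.some.injEq] at h1 h2
  exact this (h1.trans h2.symm)

/-- Matrices whose nonzero entries lie at least `k` steps above the diagonal. -/
def IsUpperBy {n : ℕ} (k : ℕ) (M : Matrix (Fin n) (Fin n) ℤ) : Prop :=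
  ∀ i j : Fin n, (j : ℕ) < i + k → M i j = 0

theorem IsUpperBy.mul {n k m : ℕ} {M N : Matrix (Fin n) (Fin n) ℤ} (hM : IsUpperBy k M)
    (hN : IsUpperBy m N) : IsUpperBy (k + m) (M * N) := by
  intro i j hij
  rw [Matrix.mul_apply]
  refine Finset.sum_eq_zero fun s _ => ?_
  by_cases h : (s : ℕ) < i + k
  · rw [hM i s h, zero_mul]
  · rw [hN s j (by omega), mul_zero]

theorem IsUpperBy.add {n k : ℕ} {M N : Matrix (Fin n) (Fin n) ℤ} (hM : IsUpperBy k M)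
    (hN : IsUpperBy k N) : IsUpperBy k (M + N) := fun i j h => by
  rw [Matrix.add_apply, hM i j h, hN i j h, add_zero]

theorem IsUpperBy.neg {n k : ℕ} {M : Matrix (Fin n) (Fin n) ℤ} (hM : IsUpperBy k M) :
    IsUpperBy k (-M) := fun i j h => by rw [Matrix.neg_apply, hM i j h, neg_zero]

theorem IsUpperBy.mono {n k m : ℕ} {M : Matrix (Fin n) (Fin n) ℤ} (hM : IsUpperBy k M)
    (h : m ≤ k) : IsUpperBy m M := fun i j hij => hM i j (by omega)

theorem isUpperBy_one {n : ℕ} : IsUpperBy 0 (1 : Matrix (Fin n) (Fin n) ℤ) := fun i j h =>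
  Matrix.one_apply_ne (by rintro rfl; omega)

/-- The group of unitriangular matrices that agree with the identity on the first `k - 1`
superdiagonals. -/
def unitriangular (n k : ℕ) : Subgroup (Matrix (Fin n) (Fin n) ℤ)ˣ where
  carrier := {u | IsUpperBy k ((u : Matrix (Fin n) (Fin n) ℤ) - 1) ∧
    IsUpperBy k ((u⁻¹ : (Matrix (Fin n) (Fin n) ℤ)ˣ) - 1 : Matrix (Fin n) (Fin n) ℤ)}
  one_mem' := by simp [IsUpperBy]
  mul_mem' := by
    have key : ∀ a b : Matrix (Fin n) (Fin n) ℤ, IsUpperBy k (a - 1) → IsUpperBy k (b - 1) →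
        IsUpperBy k (a * b - 1) := by
      intro a b ha hb
      have : a * b - 1 = (a - 1) * (b - 1) + ((a - 1) + (b - 1)) := by noncomm_ring
      rw [this]
      exact ((ha.mul hb).mono (by omega)).add (ha.add hb)
    rintro a b ⟨ha, ha'⟩ ⟨hb, hb'⟩
    refine ⟨key _ _ ha hb, ?_⟩
    rw [mul_inv_rev]
    exact key _ _ hb' ha'
  inv_mem' := by
    rintro a ⟨ha, ha'⟩
    exact ⟨ha', by rwa [inv_inv]⟩

/-- The commutator minus 1 equals ((u-1)(v-1) - (v-1)(u-1))(vu)⁻¹, which starts at superdiagonal 2k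
+ 2 ≥ k + 2. -/
theorem commutator_unitriangular_le (n k : ℕ) :
    ⁅unitriangular n (k + 1), unitriangular n (k + 1)⁆ ≤ unitriangular n (k + 2) := by
  have h0 : ∀ {w : (Matrix (Fin n) (Fin n) ℤ)ˣ}, w ∈ unitriangular n (k + 1) →
      IsUpperBy 0 (w : Matrix (Fin n) (Fin n) ℤ) := by
    intro w hw
    have := (hw.1.mono (Nat.zero_le _)).add isUpperBy_one
    rwa [sub_add_cancel] at this
  have key : ∀ u v : (Matrix (Fin n) (Fin n) ℤ)ˣ, u ∈ unitriangular n (k + 1) →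
      v ∈ unitriangular n (k + 1) →
      IsUpperBy (k + 2) ((u * v * u⁻¹ * v⁻¹ : (Matrix (Fin n) (Fin n) ℤ)ˣ) - 1 : Matrix (Fin n) (Fin n) ℤ) := by
    intro u v hu hv
    have e : ((u * v * u⁻¹ * v⁻¹ : (Matrix (Fin n) (Fin n) ℤ)ˣ) - 1 : Matrix (Fin n) (Fin n) ℤ) =
        (((u : Matrix (Fin n) (Fin n) ℤ) - 1) * ((v : Matrix (Fin n) (Fin n) ℤ) - 1) +
          -(((v : Matrix (Fin n) (Fin n) ℤ) - 1) * ((u : Matrix (Fin n) (Fin n) ℤ) - 1))) *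
          (((v * u)⁻¹ : (Matrix (Fin n) (Fin n) ℤ)ˣ) : Matrix (Fin n) (Fin n) ℤ) := by
      have : (((u : Matrix (Fin n) (Fin n) ℤ) - 1) * ((v : Matrix (Fin n) (Fin n) ℤ) - 1) +
          -(((v : Matrix (Fin n) (Fin n) ℤ) - 1) * ((u : Matrix (Fin n) (Fin n) ℤ) - 1))) =
          ((u * v : (Matrix (Fin n) (Fin n) ℤ)ˣ) : Matrix (Fin n) (Fin n) ℤ) -
          ((v * u : (Matrix (Fin n) (Fin n) ℤ)ˣ) : Matrix (Fin n) (Fin n) ℤ) := by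
        push_cast; noncomm_ring
      rw [this, sub_mul, ← Units.val_mul, ← Units.val_mul, mul_inv_cancel, mul_inv_rev, Units.val_one,
        ← mul_assoc]
    rw [e]
    have hvu := h0 (inv_mem (mul_mem hv hu))
    exact (((hu.1.mul hv.1).mono (m := k + 2) (by omega)).add
      ((hv.1.mul hu.1).mono (m := k + 2) (by omega)).neg).mul hvu
  rw [Subgroup.commutator_le]
  intro u hu v hv
  refine ⟨key u v hu hv, ?_⟩
  have e : (u * v * u⁻¹ * v⁻¹)⁻¹ = v * u * v⁻¹ * u⁻¹ := by group
  have := key v u hv hu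
  rwa [← e] at this

theorem isSolvable_unitriangular (n : ℕ) : Group.IsSolvable (unitriangular n 1) := by
  have h : ∀ k, (derivedSeries (unitriangular n 1) k).map (unitriangular n 1).subtype ≤
      unitriangular n (k + 1) := by
    intro k
    induction k with
    | zero => rw [derivedSeries_zero, ← MonoidHom.range_eq_map, Subgroup.range_subtype]
    | succ k ih =>
      rw [derivedSeries_succ, Subgroup.map_commutator]
      exact (Subgroup.commutator_mono ih ih).trans (commutator_unitriangular_le n k)
  refine ⟨⟨n, ?_⟩⟩
  rw [eq_bot_iff]
  intro x hx
  have := h n (Subgroup.mem_map_of_mem _ hx)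
  rw [Subgroup.mem_bot]
  ext i j
  have := this.1 i j (by omega)
  simpa [sub_eq_zero] using this

/-- The unitriangular matrix `1 + letterShift l x`. -/
def letterUnit {X : Type} [DecidableEq X] (l : List (X × Bool))
    (hl : l.IsChain fun p q => p.1 ≠ q.1) (x : X) : unitriangular (l.length + 1) 1 :=
  ⟨{ val := 1 + letterShift l x
     inv := 1 - letterShift l x
     val_inv := by
      have := letterShift_mul_self hl x
      calc (1 + letterShift l x) * (1 - letterShift l x)
          = 1 - letterShift l x * letterShift l x := by noncomm_ring
        _ = 1 := by rw [this, sub_zero]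
     inv_val := by
      have := letterShift_mul_self hl x
      calc (1 - letterShift l x) * (1 + letterShift l x)
          = 1 - letterShift l x * letterShift l x := by noncomm_ring
        _ = 1 := by rw [this, sub_zero] }, by
    have h : IsUpperBy 1 (letterShift l x) := by
      intro i j hij
      have : ¬ ((i : ℕ) + 1 = j) := by omega
      simp [letterShift, this]
    constructor
    · simpa using h
    · simpa using h.neg⟩

/-- A nonempty word in which consecutive letters differ and all exponents are `±1` does not
vanish under a suitable assignment of the letters in a solvable group. -/
theorem exists_isSolvable_word_ne_one {X : Type} (l : List (X × Bool)) (hne : l ≠ [])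
    (hl : l.IsChain fun p q => p.1 ≠ q.1) :
    ∃ (L : Type) (_ : Group L), Group.IsSolvable L ∧ ∃ c : X → L,
      (l.map fun p => if p.2 then c p.1 else (c p.1)⁻¹).prod ≠ 1 := by
  classical
  refine ⟨unitriangular (l.length + 1) 1, inferInstance, isSolvable_unitriangular _,
    letterUnit l hl, ?_⟩
  let M : List (X × Bool) → Matrix (Fin (l.length + 1)) (Fin (l.length + 1)) ℤ := fun t =>
    (((t.map fun p => if p.2 then letterUnit l hl p.1 else (letterUnit l hl p.1)⁻¹).prod :
      unitriangular (l.length + 1) 1) : (Matrix (Fin (l.length + 1)) (Fin (l.length + 1)) ℤ)ˣ)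
  let e : Fin (l.length + 1) → ℤ := Pi.single (Fin.last _) 1
  -- Applied to the last basis vector, the suffix of the word from position k gives a vector whose
  -- first nonzero entry is exactly at k: each further letter moves the leading entry up one place.
  -- The full word has it at 0, whereas the identity would leave it at the end.
  have key : ∀ k (hk : k ≤ l.length), (M (l.drop k)).mulVec e ⟨k, by omega⟩ ≠ 0 ∧
      ∀ i (hi : i < k), (M (l.drop k)).mulVec e ⟨i, by omega⟩ = 0 := by
    intro k hk
    induction hk using Nat.decreasingInduction with
    | self =>
      have : M (l.drop l.length) = 1 := by simp [M]
      rw [this, Matrix.one_mulVec]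
      constructor
      · have : (⟨l.length, by omega⟩ : Fin (l.length + 1)) = Fin.last _ := rfl
        simp [e, this]
      · intro i hi
        simp only [e]
        rw [Pi.single_eq_of_ne]
        exact fun h => by simpa [hi.ne] using congrArg Fin.val h
    | of_succ k hk ih =>
      obtain ⟨h1, h2⟩ := ih
      have hM : ∃ s : ℤ, s ≠ 0 ∧ M (l.drop k) =
          (1 + s • letterShift l l[k].1) * M (l.drop (k + 1)) := by
        have hcons : ∀ p t, M (p :: t) = (1 + (if p.2 then (1 : ℤ) else -1) •
            letterShift l p.1) * M t := by
          rintro ⟨p, _ | _⟩ t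
          · simp only [M, List.map_cons, List.prod_cons, Subgroup.coe_mul, Units.val_mul]
            congr 1
            rw [if_neg (by simp), if_neg (by simp), neg_one_smul, ← sub_eq_add_neg]
            rfl
          · simp only [M, List.map_cons, List.prod_cons, Subgroup.coe_mul, Units.val_mul]
            congr 1
            rw [if_pos trivial, if_pos trivial, one_smul]
            rfl
        refine ⟨if l[k].2 then 1 else -1, by split_ifs <;> norm_num, ?_⟩
        rw [List.drop_eq_getElem_cons hk, hcons]
      obtain ⟨s, hs, hM⟩ := hM
      have hv : ∀ i (hi : i < l.length), (M (l.drop k)).mulVec e ⟨i, by omega⟩ =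
          (M (l.drop (k + 1))).mulVec e ⟨i, by omega⟩ + s * (if l[i].1 = l[k].1 then
            (M (l.drop (k + 1))).mulVec e ⟨i + 1, by omega⟩ else 0) := by
        intro i hi
        rw [hM, ← Matrix.mulVec_mulVec, Matrix.add_mulVec, Matrix.one_mulVec, Pi.add_apply,
          Matrix.smul_mulVec, Pi.smul_apply, letterShift_mulVec _ _ _ _ hi, smul_eq_mul]
      constructor
      · rw [hv k hk, h2 k (by omega)]
        simpa [hs] using h1
      · intro i hi
        rw [hv i (by omega), h2 i (by omega), h2 (i + 1) (by omega)]
        simp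
  intro h
  have h0 := (key 0 (Nat.zero_le _)).1
  have hM : M (l.drop 0) = 1 := by
    simp only [M, List.drop_zero]
    rw [h]; simp
  rw [hM, Matrix.one_mulVec] at h0
  apply h0
  simp only [e]
  rw [Pi.single_eq_of_ne]
  intro h'
  exact hne (List.length_eq_zero_iff.mp (by simpa using (congrArg Fin.val h').symm))

/-! ### Solvable wreath products and residual solvability -/

theorem isSolvable_pi {I L : Type*} [Group L] [Group.IsSolvable L] :
    Group.IsSolvable (I → L) := by
  obtain ⟨n, hn⟩ := (Group.isSolvable_def L).mp inferInstance
  refine ⟨⟨n, ?_⟩⟩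
  rw [eq_bot_iff]
  intro f hf
  rw [Subgroup.mem_bot]
  ext i
  have := map_derivedSeries_le_derivedSeries (Pi.evalMonoidHom (fun _ : I => L) i) n
    (Subgroup.mem_map_of_mem _ hf)
  rwa [hn, Subgroup.mem_bot] at this

theorem isSolvable_wreath {L Q : Type*} [Group L] [Group Q] [Group.IsSolvable L]
    [Group.IsSolvable Q] : Group.IsSolvable (L ≀ᵣ Q) := by
  have := isSolvable_pi (I := Q) (L := L)
  let base : (Q → L) →* L ≀ᵣ Q :=
    { toFun := fun f => ⟨f, 1⟩
      map_one' := rfl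
      map_mul' := fun f g => by ext <;> simp }
  refine Group.isSolvable_of_ker_le_range base RegularWreathProduct.rightHom ?_
  intro x hx
  exact ⟨x.left, RegularWreathProduct.ext rfl (Eq.symm hx)⟩

theorem isResiduallySolvable_of_hom {Γ : Type} [Group Γ]
    (h : ∀ x : Γ, x ≠ 1 → ∃ (T : Type) (_ : Group T) (f : Γ →* T), Group.IsSolvable T ∧ f x ≠ 1) :
    IsResiduallySolvable Γ := by
  intro x hx
  obtain ⟨T, _, f, hT, hf⟩ := h x hx
  refine ⟨f.range, inferInstance, f.rangeRestrict, f.rangeRestrict_surjective, inferInstance, ?_⟩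
  exact fun h => hf (by simpa using congrArg Subtype.val h)

theorem IsResiduallySolvable.of_injective {Γ Δ : Type} [Group Γ] [Group Δ]
    (hΔ : IsResiduallySolvable Δ) (f : Γ →* Δ) (hf : Function.Injective f) :
    IsResiduallySolvable Γ := by
  refine isResiduallySolvable_of_hom fun x hx => ?_
  obtain ⟨T, _, g, -, hT, hg⟩ := hΔ (f x) fun h => hx (hf (h.trans f.map_one.symm))
  exact ⟨T, _, g.comp f, hT, hg⟩

theorem isResiduallySolvable_of_isSolvable {Γ : Type} [Group Γ] (h : Group.IsSolvable Γ) :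
    IsResiduallySolvable Γ :=
  isResiduallySolvable_of_hom fun _ hx => ⟨Γ, _, MonoidHom.id Γ, h, hx⟩

/-! ### Amalgams over a common retract -/

section Amalgam

variable {ι : Type} {M : ι → Type} [∀ k, Group (M k)] {H Γ : Type} [Group H] [Group Γ]

/-- A list of elements of the factors `M k` is alternating when neighbours lie in different
factors and no entry lies in the common retract. -/
def IsAlternating (i : ∀ k, H →* M k) (r : ∀ k, M k →* H) (l : List (Σ k, M k)) : Prop :=
  l.IsChain (fun p q => p.1 ≠ q.1) ∧ ∀ p ∈ l, p.2 ≠ i p.1 (r p.1 p.2)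

/-- Multiplying on the left by a factor element first absorbs the prefix from H, then merges with
the head if it lies in the same factor; a result in H becomes the new prefix. Only existence of this
form is needed, not uniqueness. -/
theorem exists_eq_mul_prod_alternating (i : ∀ k, H →* M k) (r : ∀ k, M k →* H)
    (φ : ∀ k, M k →* Γ) (φ₀ : H →* Γ) (hφ : ∀ k h, φ k (i k h) = φ₀ h)
    (hgen : Subgroup.closure (⋃ k, Set.range (φ k)) = ⊤) (x : Γ) :
    ∃ h l, IsAlternating i r l ∧ x = φ₀ h * (l.map fun p => φ p.1 p.2).prod := by
  classical
  have step : ∀ k m y, (∃ h l, IsAlternating i r l ∧ y = φ₀ h * (l.map fun p => φ p.1 p.2).prod) →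
      ∃ h l, IsAlternating i r l ∧ φ k m * y = φ₀ h * (l.map fun p => φ p.1 p.2).prod := by
    rintro k m y ⟨h, l, hl, rfl⟩
    obtain ⟨m', t, ht, hk, e⟩ : ∃ m' t, IsAlternating i r t ∧ (∀ p ∈ t.head?, k ≠ p.1) ∧
        φ k m * (φ₀ h * (l.map fun p => φ p.1 p.2).prod) =
          φ k m' * (t.map fun p => φ p.1 p.2).prod := by
      have h0 : φ k m * (φ₀ h * (l.map fun p => φ p.1 p.2).prod) =
          φ k (m * i k h) * (l.map fun p => φ p.1 p.2).prod := by
        rw [map_mul, hφ, mul_assoc]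
      rcases l with _ | ⟨⟨k', m'⟩, t⟩
      · exact ⟨m * i k h, [], hl, by simp, h0⟩
      · by_cases hkk : k = k'
        · subst hkk
          refine ⟨m * i k h * m', t, ⟨hl.1.of_cons, fun p hp => hl.2 p (by simp [hp])⟩, ?_, ?_⟩
          · intro p hp
            exact (List.isChain_cons.mp hl.1).1 p hp
          · rw [h0]; simp [mul_assoc]
        · exact ⟨m * i k h, _, hl, by simpa using hkk, h0⟩
    rw [e]
    by_cases hm : m' = i k (r k m')
    · refine ⟨r k m', t, ht, ?_⟩
      rw [← hφ k, ← hm]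
    · refine ⟨1, ⟨k, m'⟩ :: t, ⟨List.isChain_cons.mpr ⟨hk, ht.1⟩, ?_⟩, by simp⟩
      intro p hp
      rcases List.mem_cons.mp hp with rfl | hp
      · exact hm
      · exact ht.2 p hp
  have hx : x ∈ Subgroup.closure (⋃ k, Set.range (φ k)) := hgen ▸ Subgroup.mem_top x
  induction hx using Subgroup.closure_induction_left with
  | one => exact ⟨1, [], ⟨by simp, by simp⟩, by simp⟩
  | mul_left a ha y _ ih =>
    obtain ⟨k, m, rfl⟩ := Set.mem_iUnion.mp ha
    exact step k m y ih
  | inv_mul_cancel a ha y _ ih =>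
    obtain ⟨k, m, rfl⟩ := Set.mem_iUnion.mp ha
    rw [← map_inv]
    exact step k m⁻¹ y ih

theorem exists_isSolvable_separating [DecidableEq ι] (i : ∀ k, H →* M k) (r : ∀ k, M k →* H)
    (hr : ∀ k h, r k (i k h) = h) (hM : ∀ k, IsResiduallySolvable (M k))
    (l : List (Σ k, M k)) (hl : ∀ p ∈ l, p.2 ≠ i p.1 (r p.1 p.2)) :
    ∃ (D : Type) (_ : Group D) (α : ∀ k, M k →* D) (α₀ : H →* D), Group.IsSolvable D ∧
      (∀ k h, α k (i k h) = α₀ h) ∧ ∀ p ∈ l, α p.1 p.2 ≠ α₀ (r p.1 p.2) := by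
  induction l with
  | nil => exact ⟨Unit, inferInstance, fun _ => 1, 1, inferInstance, by simp, by simp⟩
  | cons p l ih =>
    obtain ⟨D, _, α, α₀, hD, hα, hsep⟩ := ih fun q hq => hl q (by simp [hq])
    obtain ⟨k, m⟩ := p
    obtain ⟨T, _, f, -, hT, hf⟩ := hM k (m * (i k (r k m))⁻¹)
      (by rw [Ne, mul_inv_eq_one]; exact hl ⟨k, m⟩ (by simp))
    -- The map f separates one entry of the list. Composing its restriction to H with the
    -- retractions extends it to the other factors, so that all agree on H; the product with D keeps
    -- the earlier separations.
    let β : ∀ κ, M κ →* T := Function.update (fun κ => f.comp ((i k).comp (r κ))) k f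
    have hβ : ∀ κ h, β κ (i κ h) = f (i k h) := by
      intro κ h
      by_cases hκ : κ = k
      · subst hκ; simp [β]
      · simp [β, hκ, hr]
    refine ⟨T × D, inferInstance, fun κ => (β κ).prod (α κ), (f.comp (i k)).prod α₀,
      inferInstance, ?_, ?_⟩
    · intro κ h; simp [hβ, hα]
    · intro p hp
      rcases List.mem_cons.mp hp with rfl | hp
      · intro h
        have h1 := congrArg Prod.fst h
        apply hf
        rw [map_mul, map_inv, mul_inv_eq_one]
        simpa [β] using h1
      · intro h
        exact hsep p hp (by simpa using congrArg Prod.snd h)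

/-- The word, in the letters `(k, c)` with `c` a coset of the diagonal of `D × D`, that describes
the base coordinate at `d` of the product of an alternating list in a twisted wreath product. -/
def cosetWord {D : Type} [Group D] (γ : ∀ k, M k →* D × D) :
    List (Σ k, M k) → D × D → List ((ι × D) × Bool)
  | [], _ => []
  | p :: t, d =>
    ((p.1, d.1⁻¹ * d.2), true) ::
      ((p.1, ((γ p.1 p.2)⁻¹ * d).1⁻¹ * ((γ p.1 p.2)⁻¹ * d).2), false) ::
        cosetWord γ t ((γ p.1 p.2)⁻¹ * d)

/-- The two letters from one entry differ because γ of that entry is off the diagonal, hence changes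
the coset of d. Letters from neighbouring entries differ in the factor index. -/
theorem isChain_cosetWord {D : Type} [Group D] (γ : ∀ k, M k →* D × D) (l : List (Σ k, M k))
    (hl : l.IsChain fun p q => p.1 ≠ q.1)
    (hγ : ∀ p ∈ l, (γ p.1 p.2).1 ≠ (γ p.1 p.2).2) (d : D × D) :
    (cosetWord γ l d).IsChain fun p q => p.1 ≠ q.1 := by
  induction l generalizing d with
  | nil => simp [cosetWord]
  | cons p t ih =>
    rw [cosetWord, List.isChain_cons, List.isChain_cons]
    refine ⟨?_, ?_, ih hl.of_cons (fun q hq => hγ q (by simp [hq])) _⟩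
    · intro q hq
      simp only [List.head?_cons, Option.mem_def, Option.some.injEq] at hq
      subst hq
      intro h
      have h2 := congrArg Prod.snd h
      simp only [Prod.fst_mul, Prod.snd_mul, Prod.fst_inv, Prod.snd_inv, mul_inv_rev, inv_inv] at h2
      rw [mul_assoc, mul_right_inj, ← mul_assoc, right_eq_mul, mul_inv_eq_one] at h2
      exact hγ p (by simp) h2
    · intro q hq h
      rcases t with _ | ⟨p', t⟩
      · simp [cosetWord] at hq
      · simp only [cosetWord, List.head?_cons, Option.mem_def, Option.some.injEq] at hq
        subst hq
        exact (List.isChain_cons_cons.mp hl).1 (congrArg Prod.fst h)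

/-- The embedding of a factor into the wreath product, twisted by a function on the cosets. -/
def twistedHom {D L : Type} [Group D] [Group L] (γ : ∀ k, M k →* D × D) (c : ι × D → L) (k : ι) :
    M k →* L ≀ᵣ (D × D) :=
  (MulAut.conj (⟨fun d => c (k, d.1⁻¹ * d.2), 1⟩ : L ≀ᵣ (D × D))).toMonoidHom.comp
    (RegularWreathProduct.inl.comp (γ k))

theorem twistedHom_left {D L : Type} [Group D] [Group L] (γ : ∀ k, M k →* D × D)
    (c : ι × D → L) (k : ι) (m : M k) (d : D × D) :
    (twistedHom γ c k m).left d = c (k, d.1⁻¹ * d.2) *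
      (c (k, ((γ k m)⁻¹ * d).1⁻¹ * ((γ k m)⁻¹ * d).2))⁻¹ := by
  simp [twistedHom]

theorem twistedHom_right {D L : Type} [Group D] [Group L] (γ : ∀ k, M k →* D × D)
    (c : ι × D → L) (k : ι) (m : M k) : (twistedHom γ c k m).right = γ k m := by
  simp [twistedHom]

theorem prod_twistedHom_left {D L : Type} [Group D] [Group L] (γ : ∀ k, M k →* D × D)
    (c : ι × D → L) (l : List (Σ k, M k)) (d : D × D) :
    (l.map fun p => twistedHom γ c p.1 p.2).prod.left d =
      ((cosetWord γ l d).map fun p => if p.2 then c p.1 else (c p.1)⁻¹).prod := by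
  induction l generalizing d with
  | nil => simp [cosetWord]
  | cons p t ih =>
    simp only [List.map_cons, List.prod_cons, cosetWord, RegularWreathProduct.mul_left,
      Pi.mul_apply, twistedHom_left, twistedHom_right, ih, if_true, mul_assoc]
    simp

/-- An amalgam of residually solvable groups over a common retract is residually solvable. -/
theorem isResiduallySolvable_amalgam [Nonempty ι] (i : ∀ k, H →* M k) (r : ∀ k, M k →* H)
    (hr : ∀ k h, r k (i k h) = h) (φ : ∀ k, M k →* Γ) (φ₀ : H →* Γ)
    (hφ : ∀ k h, φ k (i k h) = φ₀ h)
    (hgen : Subgroup.closure (⋃ k, Set.range (φ k)) = ⊤)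
    (huniv : ∀ (T : Type) [Group T] (f : ∀ k, M k →* T) (f₀ : H →* T),
      (∀ k h, f k (i k h) = f₀ h) → ∃ F : Γ →* T, ∀ k m, F (φ k m) = f k m)
    (hM : ∀ k, IsResiduallySolvable (M k)) : IsResiduallySolvable Γ := by
  classical
  refine isResiduallySolvable_of_hom fun x hx => ?_
  obtain ⟨h, l, ⟨hl, hl'⟩, rfl⟩ := exists_eq_mul_prod_alternating i r φ φ₀ hφ hgen x
  rcases eq_or_ne l [] with rfl | hne
  · obtain ⟨k⟩ := ‹Nonempty ι›
    obtain ⟨T, _, f, -, hT, hf⟩ := hM k (i k h) fun e => hx (by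
      rw [← hφ k, e]; simp)
    obtain ⟨F, hF⟩ := huniv T (fun κ => f.comp ((i k).comp (r κ))) (f.comp (i k)) (by simp [hr])
    refine ⟨T, _, F, hT, ?_⟩
    rw [← hφ k, List.map_nil, List.prod_nil, mul_one, hF]
    simpa [hr] using hf
  · obtain ⟨D, _, α, α₀, hD, hα, hsep⟩ := exists_isSolvable_separating i r hr hM l hl'
    let γ : ∀ k, M k →* D × D := fun k => (α k).prod (α₀.comp (r k))
    obtain ⟨L, _, hL, c, hc⟩ := exists_isSolvable_word_ne_one (cosetWord γ l 1)
      (by rcases l with _ | ⟨p, t⟩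
          · exact absurd rfl hne
          · simp [cosetWord])
      (isChain_cosetWord γ l hl (fun p hp => by simpa [γ] using hsep p hp) 1)
    have hW := isSolvable_wreath (L := L) (Q := D × D)
    obtain ⟨F, hF⟩ := huniv (L ≀ᵣ (D × D)) (twistedHom γ c)
      (RegularWreathProduct.inl.comp (α₀.prod α₀)) (by
        intro k h
        refine RegularWreathProduct.ext ?_ ?_
        · ext d
          rw [twistedHom_left]
          simp [γ, hα, hr, mul_assoc]
        · rw [twistedHom_right]
          simp [γ, hα, hr])
    refine ⟨_, _, F, hW, fun e => hc ?_⟩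
    -- The prefix h acts by translating base coordinates by the diagonal element (α₀ h, α₀ h).
    -- Evaluating there leaves the coordinate at 1 of the alternating product.
    have e' := congrArg (fun w => w.left (α₀ h, α₀ h)) e
    obtain ⟨k⟩ := ‹Nonempty ι›
    have hF0 : F (φ₀ h) = RegularWreathProduct.inl (α₀ h, α₀ h) := by
      rw [← hφ k, hF]
      refine RegularWreathProduct.ext ?_ ?_
      · ext d
        rw [twistedHom_left]
        simp [γ, hα, hr, mul_assoc]
      · rw [twistedHom_right]
        simp [γ, hα, hr]
    rw [← prod_twistedHom_left]
    change _root_.RegularWreathProduct.left _ (1, 1) = 1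
    simp only [map_mul, hF0, map_list_prod, List.map_map, Function.comp_def, hF] at e'
    simpa using e'

end Amalgam

/-! ### Groups presented on a cycle of generators -/

theorem map_freeGroup_lift {X T U : Type*} [Group T] [Group U] (f : T →* U) (g : X → T)
    (w : FreeGroup X) : f (FreeGroup.lift g w) = FreeGroup.lift (fun x => f (g x)) w := by
  have : f.comp (FreeGroup.lift g) = FreeGroup.lift (fun x => f (g x)) := by ext; simp
  exact DFunLike.congr_fun this w

theorem map_lift_pair {T U : Type*} [Group T] [Group U] (f : T →* U) (x y : T)
    (w : FreeGroup (Fin 2)) :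
    f (FreeGroup.lift ![x, y] w) = FreeGroup.lift ![f x, f y] w := by
  rw [map_freeGroup_lift]
  congr 2
  ext i
  fin_cases i <;> rfl

/-- Relators on two letters that become trivial when either letter is killed. -/
def VanishOnAxes (R : Set (FreeGroup (Fin 2))) : Prop :=
  ∀ r ∈ R, ∀ (T : Type) [Group T] (t : T),
    FreeGroup.lift ![t, 1] r = 1 ∧ FreeGroup.lift ![1, t] r = 1

/-- Relators on letters indexed by `ZMod k`: those of `R` for each pair of consecutive letters,
and all letters outside `S`. -/
def cycleRelators (k : ℕ) (R : Set (FreeGroup (Fin 2))) (S : Finset (ZMod k)) :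
    Set (FreeGroup (ZMod k)) :=
  {w | ∃ v, ∃ r ∈ R, w = FreeGroup.lift ![FreeGroup.of v, FreeGroup.of (v + 1)] r} ∪
    {w | ∃ v, v ∉ S ∧ w = FreeGroup.of v}

/-- The group with one generator for each element of `S`, in which consecutive generators satisfy
the relators `R`. -/
abbrev CycleGroup (k : ℕ) (R : Set (FreeGroup (Fin 2))) (S : Finset (ZMod k)) : Type :=
  PresentedGroup (cycleRelators k R S)

namespace CycleGroup

variable {k : ℕ} {R : Set (FreeGroup (Fin 2))} {S S' : Finset (ZMod k)}

/-- The generator with index `v`; it is trivial when `v ∉ S`. -/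
def gen (S : Finset (ZMod k)) (v : ZMod k) : CycleGroup k R S := PresentedGroup.of v

theorem gen_eq_one {v : ZMod k} (hv : v ∉ S) : (gen S v : CycleGroup k R S) = 1 :=
  PresentedGroup.one_of_mem (Or.inr ⟨v, hv, rfl⟩)

theorem lift_gen (v : ZMod k) {r : FreeGroup (Fin 2)} (hr : r ∈ R) :
    FreeGroup.lift ![(gen S v : CycleGroup k R S), gen S (v + 1)] r = 1 := by
  have h : PresentedGroup.mk (cycleRelators k R S)
      (FreeGroup.lift ![FreeGroup.of v, FreeGroup.of (v + 1)] r) = 1 :=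
    PresentedGroup.one_of_mem (Or.inl ⟨v, r, hr, rfl⟩)
  rwa [map_lift_pair] at h

/-- The homomorphism determined by the images of the generators. -/
def hom {T : Type*} [Group T] (x : ZMod k → T)
    (hx : ∀ v, ∀ r ∈ R, FreeGroup.lift ![x v, x (v + 1)] r = 1) (hS : ∀ v, v ∉ S → x v = 1) :
    CycleGroup k R S →* T :=
  PresentedGroup.toGroup (f := x) (by
    rintro w (⟨v, r, hr, rfl⟩ | ⟨v, hv, rfl⟩)
    · rw [map_lift_pair, FreeGroup.lift_apply_of, FreeGroup.lift_apply_of]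
      exact hx v r hr
    · rw [FreeGroup.lift_apply_of]
      exact hS v hv)

@[simp]
theorem hom_gen {T : Type*} [Group T] (x : ZMod k → T)
    (hx : ∀ v, ∀ r ∈ R, FreeGroup.lift ![x v, x (v + 1)] r = 1) (hS : ∀ v, v ∉ S → x v = 1)
    (v : ZMod k) : hom x hx hS (gen S v) = x v :=
  PresentedGroup.toGroup.of _

theorem hom_ext {T : Type*} [Group T] {f g : CycleGroup k R S →* T}
    (h : ∀ v, f (gen S v) = g (gen S v)) : f = g :=
  PresentedGroup.ext h

theorem eq_top_of_gen_mem (N : Subgroup (CycleGroup k R S)) (h : ∀ v, gen S v ∈ N) : N = ⊤ :=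
  eq_top_iff.mpr fun x _ => PresentedGroup.generated_by _ N h x

/-- The retraction that kills the generators outside `S`. -/
def proj (h : S ⊆ S') : CycleGroup k R S' →* CycleGroup k R S :=
  hom (gen S) (fun v _ hr => lift_gen v hr) fun _ hv => gen_eq_one fun hv' => hv (h hv')

@[simp]
theorem proj_gen (h : S ⊆ S') (v : ZMod k) :
    proj h (gen S' v : CycleGroup k R S') = gen S v := hom_gen _ _ _ v

open Classical in
/-- The inclusion, which sends each generator to the generator with the same index. -/
noncomputable def incl (hR : VanishOnAxes R) (S S' : Finset (ZMod k)) :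
    CycleGroup k R S →* CycleGroup k R S' :=
  hom (fun v => if v ∈ S then gen S' v else 1) (fun v r hr => by
    split_ifs with h1 h2 h2
    · exact lift_gen v hr
    · exact (hR r hr _ _).1
    · exact (hR r hr _ _).2
    · exact (hR r hr _ _).1) fun v hv => if_neg hv

theorem incl_gen (hR : VanishOnAxes R) {v : ZMod k} (hv : v ∈ S) :
    incl hR S S' (gen S v) = gen S' v := by
  rw [incl, hom_gen, if_pos hv]

/-- As u and v are not adjacent, every relator omits one of them and already holds in one of the two
smaller groups. This gives the universal property of an amalgam. -/
theorem isResiduallySolvable_of_erase (hR : VanishOnAxes R) {u v : ZMod k} (hu : u ∈ S)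
    (huv : u ≠ v) (huv1 : v ≠ u + 1) (hvu1 : u ≠ v + 1)
    (h1 : IsResiduallySolvable (CycleGroup k R (S.erase u)))
    (h2 : IsResiduallySolvable (CycleGroup k R (S.erase v))) :
    IsResiduallySolvable (CycleGroup k R S) := by
  let E : Bool → Finset (ZMod k) := fun b => S.erase (cond b u v)
  let C := (S.erase u).erase v
  have hC : ∀ b, C ⊆ E b := by
    rintro (_ | _) w hw <;> simp only [C, E, Finset.mem_erase, cond_true, cond_false] at hw ⊢ <;>
      tauto
  have hE : ∀ b, E b ⊆ S := fun b => Finset.erase_subset _ _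
  refine isResiduallySolvable_amalgam (ι := Bool) (M := fun b => CycleGroup k R (E b))
    (H := CycleGroup k R C) (fun b => incl hR C (E b)) (fun b => proj (hC b)) ?_
    (fun b => incl hR (E b) S) (incl hR C S) ?_ ?_ ?_ ?_
  · intro b h
    refine DFunLike.congr_fun (f := (proj (hC b)).comp (incl hR C (E b)))
      (g := MonoidHom.id _) (hom_ext fun w => ?_) h
    by_cases hw : w ∈ C
    · simp [incl_gen hR hw]
    · simp [gen_eq_one hw]
  · intro b h
    refine DFunLike.congr_fun (f := (incl hR (E b) S).comp (incl hR C (E b)))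
      (g := incl hR C S) (hom_ext fun w => ?_) h
    by_cases hw : w ∈ C
    · simp [incl_gen hR hw, incl_gen hR (hC b hw)]
    · simp [gen_eq_one hw]
  · refine eq_top_of_gen_mem _ fun w => ?_
    by_cases hw : w ∈ S
    · have : ∃ b, w ∈ E b := by
        by_cases hwu : w = u
        · subst hwu
          exact ⟨false, by simp [E, hw, huv]⟩
        · exact ⟨true, by simp [E, hw, hwu]⟩
      obtain ⟨b, hb⟩ := this
      exact Subgroup.subset_closure (Set.mem_iUnion.mpr ⟨b, gen (E b) w, incl_gen hR hb⟩)
    · rw [gen_eq_one hw]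
      exact one_mem _
  · intro T _ f f₀ hf
    have hagree : ∀ w, w ≠ u → w ≠ v → f true (gen _ w) = f false (gen _ w) := by
      intro w hwu hwv
      by_cases hw : w ∈ C
      · rw [← incl_gen hR (S := C) (S' := E true) hw, ← incl_gen hR (S := C) (S' := E false) hw,
          hf, hf]
      · have hw' : w ∉ S := fun h => hw (by simp [C, h, hwu, hwv])
        rw [gen_eq_one fun h => hw' (hE _ h), gen_eq_one fun h => hw' (hE _ h), map_one, map_one]
    let x : ZMod k → T := fun w => if w = u then f false (gen _ w) else f true (gen _ w)
    have hxt : ∀ w, w ≠ u → x w = f true (gen _ w) := fun w hw => if_neg hw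
    have hxf : ∀ w, w ≠ v → x w = f false (gen _ w) := by
      intro w hw
      by_cases hwu : w = u
      · exact if_pos hwu
      · rw [hxt w hwu, hagree w hwu hw]
    have hx : ∀ w, ∀ r ∈ R, FreeGroup.lift ![x w, x (w + 1)] r = 1 := by
      intro w r hr
      -- Either the pair (w, w + 1) avoids u, and `f true` applies, or it contains u, hence avoids
      -- v, and `f false` applies.
      by_cases hw : w ≠ u ∧ w + 1 ≠ u
      · rw [hxt _ hw.1, hxt _ hw.2, ← map_lift_pair, lift_gen w hr, map_one]
      · have : w ≠ v ∧ w + 1 ≠ v := by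
          by_cases hwu : w = u
          · subst hwu
            exact ⟨huv, huv1.symm⟩
          · have hw1 : w + 1 = u := by tauto
            exact ⟨fun h => hvu1 (by rw [← hw1, h]), fun h => huv (hw1.symm.trans h)⟩
        rw [hxf _ this.1, hxf _ this.2, ← map_lift_pair, lift_gen w hr, map_one]
    have hxS : ∀ w, w ∉ S → x w = 1 := by
      intro w hw
      by_cases hwu : w = u
      · exact absurd (hwu ▸ hu) hw
      · rw [hxt w hwu, gen_eq_one fun h => hw (hE _ h), map_one]
    refine ⟨hom x hx hxS, fun b m => ?_⟩
    refine DFunLike.congr_fun (f := (hom x hx hxS).comp (incl hR (E b) S)) (g := f b)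
      (hom_ext fun w => ?_) m
    by_cases hw : w ∈ E b
    · rw [MonoidHom.comp_apply, incl_gen hR hw, hom_gen]
      rcases b with _ | _
      · exact hxf w (Finset.ne_of_mem_erase hw)
      · exact hxt w (Finset.ne_of_mem_erase hw)
    · simp [gen_eq_one hw]
  · rintro (_ | _)
    · exact h2
    · exact h1

theorem isSolvable_of_subset_pair (hG : Group.IsSolvable (PresentedGroup R)) {u : ZMod k}
    (hS : S ⊆ {u, u + 1}) : Group.IsSolvable (CycleGroup k R S) := by
  let f : PresentedGroup R →* CycleGroup k R S :=
    PresentedGroup.toGroup (f := ![gen S u, gen S (u + 1)]) fun r hr => lift_gen u hr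
  refine Group.isSolvable_of_surjective (f := f) (MonoidHom.range_eq_top.mp ?_)
  refine eq_top_of_gen_mem _ fun w => ?_
  by_cases hw : w ∈ S
  · have h := hS hw
    rw [Finset.mem_insert, Finset.mem_singleton] at h
    rcases h with rfl | rfl
    · exact ⟨PresentedGroup.of 0, PresentedGroup.toGroup.of _⟩
    · exact ⟨PresentedGroup.of 1, PresentedGroup.toGroup.of _⟩
  · rw [gen_eq_one hw]
    exact one_mem _

/-- This is where k ≥ 4 enters: the cycle must contain no triangle, which needs 1, 2 and 3 to be
nonzero modulo k. -/
theorem subset_pair_of_adjacent (hk : 4 ≤ k)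
    (h : ∀ u ∈ S, ∀ v ∈ S, u = v ∨ v = u + 1 ∨ u = v + 1) : ∃ u, S ⊆ {u, u + 1} := by
  have hne : ∀ n : ℕ, 0 < n → n < 4 → (n : ZMod k) ≠ 0 := by
    intro n h0 h4 hn
    rw [ZMod.natCast_eq_zero_iff] at hn
    exact absurd (Nat.le_of_dvd h0 hn) (by omega)
  have h1 := hne 1 (by norm_num) (by norm_num)
  have h2 := hne 2 (by norm_num) (by norm_num)
  have h3 := hne 3 (by norm_num) (by norm_num)
  push_cast at h1 h2 h3
  rcases S.eq_empty_or_nonempty with rfl | ⟨u, hu⟩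
  · exact ⟨0, by simp⟩
  by_cases hu' : u + 1 ∈ S
  · refine ⟨u, fun w hw => ?_⟩
    rw [Finset.mem_insert, Finset.mem_singleton]
    rcases h u hu w hw with e | e | e
    · exact Or.inl e.symm
    · exact Or.inr e
    -- Here w = u - 1 and u + 1 would both lie in S, and their being equal or adjacent forces 2, 3
    -- or 1 to vanish.
    · exfalso
      rcases h _ hu' w hw with e' | e' | e'
      · exact h2 (by linear_combination e' - e)
      · exact h3 (by linear_combination -e - e')
      · exact h1 (by linear_combination e' - e)
  · refine ⟨u - 1, fun w hw => ?_⟩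
    rw [Finset.mem_insert, Finset.mem_singleton]
    rcases h u hu w hw with e | e | e
    · right; linear_combination -e
    · exact absurd (e ▸ hw) hu'
    · left; linear_combination -e

theorem isResiduallySolvable (hk : 4 ≤ k) (hR : VanishOnAxes R)
    (hG : Group.IsSolvable (PresentedGroup R)) (S : Finset (ZMod k)) :
    IsResiduallySolvable (CycleGroup k R S) := by
  induction S using Finset.strongInduction with
  | H S ih =>
    by_cases h : ∀ u ∈ S, ∀ v ∈ S, u = v ∨ v = u + 1 ∨ u = v + 1
    · obtain ⟨u, hu⟩ := subset_pair_of_adjacent hk h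
      exact isResiduallySolvable_of_isSolvable (isSolvable_of_subset_pair hG hu)
    · push Not at h
      obtain ⟨u, hu, v, hv, h1, h2, h3⟩ := h
      exact isResiduallySolvable_of_erase hR hu h1 h2 h3 (ih _ (Finset.erase_ssubset hu))
        (ih _ (Finset.erase_ssubset hv))

end CycleGroup

/-! ### Comparison of the glued free product with the cycle presentation -/

theorem isResiduallySolvable_higBarCyclic {k : ℕ} (hk : 4 ≤ k) {R : Set (FreeGroup (Fin 2))}
    (hR : VanishOnAxes R) (hG : Group.IsSolvable (PresentedGroup R))
    (h : orderOf (genA R) = orderOf (genB R)) :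
    IsResiduallySolvable (HigBarCyclic k (genA R) (genB R) h) := by
  have : NeZero k := ⟨by omega⟩
  let Γ := CycleGroup k R Finset.univ
  let ofG : ZMod k → PresentedGroup R →* HigBarCyclic k (genA R) (genB R) h := fun i =>
    (QuotientGroup.mk' _).comp (Monoid.CoprodI.of (M := fun _ : ZMod k => PresentedGroup R) (i := i))
  have hglue : ∀ i, ofG i (genB R) = ofG (i + 1) (genA R) := by
    intro i
    rw [← mul_inv_eq_one, ← map_inv]
    refine (QuotientGroup.eq_one_iff _).mpr (Subgroup.subset_normalClosure ?_)
    refine ⟨i, ⟨genB R, Subgroup.mem_zpowers _⟩, ?_⟩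
    rw [cyclicIso_apply, map_inv]
  let toΓ : ∀ _ : ZMod k, PresentedGroup R →* Γ := fun i =>
    PresentedGroup.toGroup (f := ![CycleGroup.gen _ i, CycleGroup.gen _ (i + 1)])
      fun r hr => CycleGroup.lift_gen i hr
  have htoA : ∀ i, toΓ i (genA R) = CycleGroup.gen _ i := fun i => PresentedGroup.toGroup.of _
  have htoB : ∀ i, toΓ i (genB R) = CycleGroup.gen _ (i + 1) :=
    fun i => PresentedGroup.toGroup.of _
  let F : HigBarCyclic k (genA R) (genB R) h →* Γ :=
    QuotientGroup.lift _ (Monoid.CoprodI.lift toΓ) (by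
      refine Subgroup.normalClosure_le_normal ?_
      rintro _ ⟨i, ⟨_, n, rfl⟩, rfl⟩
      have e : (⟨genB R ^ n, ⟨n, rfl⟩⟩ : Subgroup.zpowers (genB R)) =
          ⟨genB R, Subgroup.mem_zpowers _⟩ ^ n := rfl
      have e' : ((cyclicIso h ⟨genB R ^ n, ⟨n, rfl⟩⟩ : Subgroup.zpowers (genA R)) :
          PresentedGroup R) = genA R ^ n := by
        rw [e, map_zpow, cyclicIso_apply]
        rfl
      change Monoid.CoprodI.lift toΓ _ = 1
      rw [map_mul, map_inv, Monoid.CoprodI.lift_of, Monoid.CoprodI.lift_of, e', map_zpow, map_zpow, htoA,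
        mul_inv_eq_one]
      rw [htoB])
  let F' : Γ →* HigBarCyclic k (genA R) (genB R) h :=
    CycleGroup.hom (fun i => ofG i (genA R)) (fun i r hr => by
      rw [← hglue, ← map_lift_pair]
      have : FreeGroup.lift ![genA R, genB R] r = 1 := by
        have e : FreeGroup.lift ![genA R, genB R] = PresentedGroup.mk R := by
          ext j
          fin_cases j <;> simp [genA, genB, letterA, letterB]
        rw [e]
        exact PresentedGroup.one_of_mem hr
      rw [this, map_one]) fun v hv => absurd (Finset.mem_univ v) hv
  have hF : ∀ i g, F (ofG i g) = toΓ i g := by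
    intro i g
    change Monoid.CoprodI.lift toΓ (Monoid.CoprodI.of g) = _
    rw [Monoid.CoprodI.lift_of]
  have hF' : F'.comp F = MonoidHom.id _ := by
    refine QuotientGroup.monoidHom_ext _ (Monoid.CoprodI.ext_hom _ _ fun i => ?_)
    refine PresentedGroup.ext fun j => ?_
    change F' (F (ofG i (PresentedGroup.of j))) = ofG i (PresentedGroup.of j)
    rw [hF]
    fin_cases j
    · change F' (toΓ i (genA R)) = ofG i (genA R)
      rw [htoA]
      exact CycleGroup.hom_gen _ _ _ _
    · change F' (toΓ i (genB R)) = ofG i (genB R)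
      rw [htoB, hglue]
      exact CycleGroup.hom_gen _ _ _ _
  exact (CycleGroup.isResiduallySolvable hk hR hG Finset.univ).of_injective F
    (Function.LeftInverse.injective (g := F') fun x => DFunLike.congr_fun hF' x)

/-! ### Solvability of the four groups -/

theorem commute_of_mem_closure {G : Type*} [Group G] {X : Set G}
    (hX : ∀ x ∈ X, ∀ y ∈ X, x * y = y * x) {x y : G} (hx : x ∈ Subgroup.closure X)
    (hy : y ∈ Subgroup.closure X) : x * y = y * x :=
  Set.centralizer_centralizer_comm_of_comm hX _
    (Subgroup.closure_le_centralizer_centralizer X hx) _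
    (Subgroup.closure_le_centralizer_centralizer X hy)

theorem conjBy_mem_closure {G : Type*} [Group G] {X : Set G} {g : G}
    (hX : ∀ x ∈ X, conjBy x g ∈ Subgroup.closure X) {x : G} (hx : x ∈ Subgroup.closure X) :
    conjBy x g ∈ Subgroup.closure X := by
  induction hx using Subgroup.closure_induction with
  | mem x hx => exact hX x hx
  | one => simp [conjBy]
  | mul x y _ _ hx hy =>
    have : conjBy (x * y) g = conjBy x g * conjBy y g := by simp [conjBy, mul_assoc]
    rw [this]
    exact mul_mem hx hy
  | inv x _ hx =>
    have : conjBy x⁻¹ g = (conjBy x g)⁻¹ := by simp [conjBy, mul_assoc]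
    rw [this]
    exact inv_mem hx

/-- A two-generator group is metabelian when its commutator lies in a subgroup generated by a
commuting set and stable under conjugation by the generators and their inverses. -/
theorem isSolvable_of_commuting_set {G : Type*} [Group G] {a b : G}
    (hab : Subgroup.closure {a, b} = ⊤) (X : Set G) (hX : ∀ x ∈ X, ∀ y ∈ X, x * y = y * x)
    (hconj : ∀ g ∈ ({a, a⁻¹, b, b⁻¹} : Set G), ∀ x ∈ X, conjBy x g ∈ Subgroup.closure X)
    (hc : commBy a b ∈ Subgroup.closure X) : Group.IsSolvable G := by
  let N := Subgroup.closure X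
  have hN : N.Normal := by
    have key : ∀ g : G, (∀ x ∈ X, conjBy x g ∈ N) → (∀ x ∈ X, conjBy x g⁻¹ ∈ N) →
        g ∈ Subgroup.normalizer (N : Set G) := by
      intro g h1 h2
      rw [Subgroup.mem_normalizer_iff]
      intro h
      constructor
      · intro hh
        simpa [conjBy] using conjBy_mem_closure h2 hh
      · intro hh
        simpa [conjBy, mul_assoc] using conjBy_mem_closure h1 hh
    rw [← Subgroup.normalizer_eq_top_iff, eq_top_iff, ← hab, Subgroup.closure_le]
    rintro g (rfl | rfl)
    · exact key _ (hconj _ (by simp)) (hconj _ (by simp))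
    · exact key _ (hconj _ (by simp)) (hconj _ (by simp))
  have hsub : Group.IsSolvable N :=
    Group.isSolvable_of_comm fun x y => Subtype.ext (commute_of_mem_closure hX x.2 y.2)
  have hquot : Group.IsSolvable (G ⧸ N) := by
    have htop : Subgroup.closure {(QuotientGroup.mk' N a), QuotientGroup.mk' N b} = ⊤ := by
      rw [← Set.image_pair, ← MonoidHom.map_closure, hab,
        Subgroup.map_top_of_surjective _ (QuotientGroup.mk'_surjective N)]
    have hcomm : QuotientGroup.mk' N a * QuotientGroup.mk' N b =
        QuotientGroup.mk' N b * QuotientGroup.mk' N a := by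
      rw [← map_mul, ← map_mul]
      refine (QuotientGroup.eq.mpr ?_).symm
      have : (b * a)⁻¹ * (a * b) = commBy a b := by simp [commBy, mul_assoc]
      rw [this]
      exact hc
    refine Group.isSolvable_of_comm fun x y => commute_of_mem_closure
      (X := {(QuotientGroup.mk' N a), QuotientGroup.mk' N b}) ?_ (htop ▸ Subgroup.mem_top x)
      (htop ▸ Subgroup.mem_top y)
    rintro _ (rfl | rfl) _ (rfl | rfl)
    · rfl
    · exact hcomm
    · exact hcomm.symm
    · rfl
  exact (Group.isSolvable_iff_subgroup_quotient N).mpr ⟨hsub, hquot⟩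

theorem closure_genA_genB (R : Set (FreeGroup (Fin 2))) :
    Subgroup.closure {genA R, genB R} = ⊤ := by
  rw [← PresentedGroup.closure_range_of]
  congr 1
  ext x
  simp only [Set.mem_insert_iff, Set.mem_singleton_iff, Set.mem_range, Fin.exists_fin_two]
  exact ⟨fun h => h.imp Eq.symm Eq.symm, fun h => h.imp Eq.symm Eq.symm⟩

theorem map_commBy {G H : Type*} [Group G] [Group H] (f : G →* H) (x y : G) :
    f (commBy x y) = commBy (f x) (f y) := by simp [commBy]

theorem map_conjBy {G H : Type*} [Group G] [Group H] (f : G →* H) (x y : G) :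
    f (conjBy x y) = conjBy (f x) (f y) := by simp [conjBy]

theorem commBy_eq_one_iff {G : Type*} [Group G] {x y : G} : commBy x y = 1 ↔ x * y = y * x := by
  have : commBy x y = (y * x)⁻¹ * (x * y) := by simp [commBy, mul_assoc]
  rw [this, inv_mul_eq_one, eq_comm]

theorem isSolvable_zSquare : Group.IsSolvable (PresentedGroup zSquareRelators) := by
  refine isSolvable_of_commuting_set (closure_genA_genB _) ∅ (by simp) (by simp) ?_
  have h : genA zSquareRelators * genB zSquareRelators =
      genB zSquareRelators * genA zSquareRelators := by
    have := PresentedGroup.one_of_mem (rels := zSquareRelators) rfl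
    rwa [map_mul, map_inv, mul_inv_eq_one, map_mul, map_mul] at this
  rw [commBy_eq_one_iff.mpr h]
  exact one_mem _

theorem isSolvable_heisenberg : Group.IsSolvable (PresentedGroup heisenbergRelators) := by
  set a := genA heisenbergRelators with ha
  set b := genB heisenbergRelators with hb
  have h1 : a * commBy a b = commBy a b * a := by
    have := PresentedGroup.one_of_mem (rels := heisenbergRelators) (Or.inl rfl)
    rwa [map_commBy, map_commBy, commBy_eq_one_iff] at this
  have h2 : b * commBy a b = commBy a b * b := by
    have := PresentedGroup.one_of_mem (rels := heisenbergRelators) (Or.inr rfl)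
    rwa [map_commBy, map_commBy, commBy_eq_one_iff] at this
  have hconj : ∀ g : PresentedGroup heisenbergRelators, g * commBy a b = commBy a b * g →
      conjBy (commBy a b) g = commBy a b := by
    intro g hg
    rw [conjBy, mul_assoc, ← hg, inv_mul_cancel_left]
  refine isSolvable_of_commuting_set (closure_genA_genB _) {commBy a b} (by simp) ?_
    (Subgroup.subset_closure rfl)
  rintro g hg _ rfl
  rw [hconj g]
  · exact Subgroup.subset_closure rfl
  · rcases hg with rfl | rfl | rfl | rfl
    · exact h1
    · exact (Commute.inv_left (a := a) h1)
    · exact h2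
    · exact (Commute.inv_left (a := b) h2)

theorem isSolvable_wreathRelators : Group.IsSolvable (PresentedGroup wreathRelators) := by
  set a := genA wreathRelators with ha
  set b := genB wreathRelators with hb
  have hcomm : ∀ i j : ℤ, conjBy a (b ^ i) * conjBy a (b ^ j) =
      conjBy a (b ^ j) * conjBy a (b ^ i) := by
    intro i j
    have := PresentedGroup.one_of_mem (rels := wreathRelators) ⟨i, j, rfl⟩
    rwa [map_commBy, map_conjBy, map_conjBy, commBy_eq_one_iff, map_zpow, map_zpow] at this
  let X := Set.range fun i : ℤ => conjBy a (b ^ i)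
  have hX : ∀ x ∈ X, ∀ y ∈ X, x * y = y * x := by
    rintro _ ⟨i, rfl⟩ _ ⟨j, rfl⟩
    exact hcomm i j
  have haX : a ∈ Subgroup.closure X := Subgroup.subset_closure ⟨0, by simp [conjBy]⟩
  have hbn : ∀ n i : ℤ, conjBy (conjBy a (b ^ i)) (b ^ n) = conjBy a (b ^ (i + n)) := by
    intro n i
    simp only [conjBy]
    group
  refine isSolvable_of_commuting_set (closure_genA_genB _) X hX ?_ ?_
  · intro g hg x hx
    have hmem := Subgroup.subset_closure hx
    rcases hg with rfl | rfl | rfl | rfl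
    · exact mul_mem (mul_mem (inv_mem haX) hmem) haX
    · exact mul_mem (mul_mem (inv_mem (inv_mem haX)) hmem) (inv_mem haX)
    · obtain ⟨i, rfl⟩ := hx
      have := hbn 1 i
      rw [zpow_one] at this
      exact Subgroup.subset_closure ⟨_, this.symm⟩
    · obtain ⟨i, rfl⟩ := hx
      have := hbn (-1) i
      rw [zpow_neg_one] at this
      exact Subgroup.subset_closure ⟨_, this.symm⟩
  · have h : conjBy a b ∈ Subgroup.closure X := Subgroup.subset_closure ⟨1, by simp⟩
    have e : commBy a b = a⁻¹ * conjBy a b := by simp [commBy, conjBy, mul_assoc]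
    rw [e]
    exact mul_mem (inv_mem haX) h

/-- The relators only say that c commutes with each c^(a^i b^j), and the elements a^i b^j do not
form a subgroup. Since b^n a^m = a^m b^n w with w a product of such conjugates and their inverses,
conjugation by a nevertheless preserves the subgroup they generate. -/
theorem isSolvable_metabelian : Group.IsSolvable (PresentedGroup metabelianRelators) := by
  set a := genA metabelianRelators with ha
  set b := genB metabelianRelators with hb
  set c := commBy a b with hc
  let K : ℤ → ℤ → PresentedGroup metabelianRelators := fun i j => conjBy c (a ^ i * b ^ j)
  have hK : ∀ i j, Commute c (K i j) := by
    intro i j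
    have := PresentedGroup.one_of_mem (rels := metabelianRelators) ⟨i, j, rfl⟩
    rwa [map_commBy, map_conjBy, map_commBy, commBy_eq_one_iff, map_mul, map_zpow, map_zpow]
      at this
  let X := Set.range fun p : ℤ × ℤ => K p.1 p.2
  have hKX : ∀ i j, K i j ∈ Subgroup.closure X := fun i j => Subgroup.subset_closure ⟨(i, j), rfl⟩
  -- Conjugation by a permutes the c^(a^i) outright; for c^(a^i b^j) with j ≠ 0 its effect is
  -- controlled only by `hw`, whose proof rests on this smaller family.
  let X₀ := Set.range fun i : ℤ => K i 0
  have hX₀ : Subgroup.closure X₀ ≤ Subgroup.closure X := by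
    refine Subgroup.closure_mono ?_
    rintro _ ⟨i, rfl⟩
    exact ⟨(i, 0), rfl⟩
  have hconjb : ∀ n : ℤ, ∀ x ∈ Subgroup.closure X, conjBy x (b ^ n) ∈ Subgroup.closure X := by
    intro n x hx
    refine conjBy_mem_closure ?_ hx
    rintro _ ⟨⟨i, j⟩, rfl⟩
    refine Subgroup.subset_closure ⟨(i, j + n), ?_⟩
    simp only [K, conjBy]
    group
  have hconja : ∀ n : ℤ, ∀ x ∈ Subgroup.closure X₀, conjBy x (a ^ n) ∈ Subgroup.closure X₀ := by
    intro n x hx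
    refine conjBy_mem_closure ?_ hx
    rintro _ ⟨i, rfl⟩
    refine Subgroup.subset_closure ⟨i + n, ?_⟩
    simp only [K, conjBy]
    group
  have hc0 : c ∈ Subgroup.closure X₀ := Subgroup.subset_closure ⟨0, by simp [K, conjBy]⟩
  have hv : ∀ m : ℤ, b⁻¹ * a ^ (-m) * b * a ^ m ∈ Subgroup.closure X₀ := by
    intro m
    induction m using Int.induction_on with
    | zero => simp
    | succ m ih =>
      have e : b⁻¹ * a ^ (-((m : ℤ) + 1)) * b * a ^ ((m : ℤ) + 1) =
          c⁻¹ * conjBy (b⁻¹ * a ^ (-(m : ℤ)) * b * a ^ (m : ℤ)) (a ^ (1 : ℤ)) := by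
        simp only [hc, commBy, conjBy]
        group
      rw [e]
      exact mul_mem (inv_mem hc0) (hconja _ _ ih)
    | pred m ih =>
      have e : b⁻¹ * a ^ (-(-(m : ℤ) - 1)) * b * a ^ (-(m : ℤ) - 1) =
          conjBy (c * (b⁻¹ * a ^ (-(-(m : ℤ))) * b * a ^ (-(m : ℤ)))) (a ^ (-1 : ℤ)) := by
        simp only [hc, commBy, conjBy]
        group
      rw [e]
      exact hconja _ _ (mul_mem hc0 ih)
  have hw : ∀ m n : ℤ, b ^ (-n) * a ^ (-m) * b ^ n * a ^ m ∈ Subgroup.closure X := by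
    intro m n
    induction n using Int.induction_on with
    | zero => simp
    | succ n ih =>
      have e : b ^ (-((n : ℤ) + 1)) * a ^ (-m) * b ^ ((n : ℤ) + 1) * a ^ m =
          conjBy (b ^ (-(n : ℤ)) * a ^ (-m) * b ^ (n : ℤ) * a ^ m) (b ^ (1 : ℤ)) *
            (b⁻¹ * a ^ (-m) * b * a ^ m) := by
        simp only [conjBy]
        group
      rw [e]
      exact mul_mem (hconjb _ _ ih) (hX₀ (hv m))
    | pred n ih =>
      have e : b ^ (-(-(n : ℤ) - 1)) * a ^ (-m) * b ^ (-(n : ℤ) - 1) * a ^ m =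
          conjBy (b ^ (-(-(n : ℤ))) * a ^ (-m) * b ^ (-(n : ℤ)) * a ^ m *
            (b⁻¹ * a ^ (-m) * b * a ^ m)⁻¹) (b ^ (-1 : ℤ)) := by
        simp only [conjBy]
        group
      rw [e]
      exact hconjb _ _ (mul_mem ih (inv_mem (hX₀ (hv m))))
  have hcX : ∀ x ∈ Subgroup.closure X, Commute c x := by
    intro x hx
    induction hx using Subgroup.closure_induction with
    | mem x hx => obtain ⟨⟨i, j⟩, rfl⟩ := hx; exact hK i j
    | one => exact Commute.one_right _
    | mul x y _ _ hx hy => exact hx.mul_right hy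
    | inv x _ hx => exact hx.inv_right
  have hKa : ∀ i n m : ℤ, conjBy (K i n) (a ^ m) ∈ Subgroup.closure X := by
    intro i n m
    have e : conjBy (K i n) (a ^ m) = (b ^ (-n) * a ^ (-m) * b ^ n * a ^ m)⁻¹ * K (i + m) n *
        (b ^ (-n) * a ^ (-m) * b ^ n * a ^ m) := by
      simp only [K, conjBy]
      group
    rw [e]
    exact mul_mem (mul_mem (inv_mem (hw m n)) (hKX _ _)) (hw m n)
  have hX : ∀ x ∈ X, ∀ y ∈ X, x * y = y * x := by
    rintro _ ⟨⟨i, j⟩, rfl⟩ _ ⟨⟨i', j'⟩, rfl⟩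
    -- Conjugating both elements by (a^i' b^j')⁻¹ turns the second into c, and `hKa` puts the first
    -- into the subgroup that c centralizes.
    have h := hcX _ (hKa i (j - j') (-i'))
    have e : K i j = conjBy (conjBy (K i (j - j')) (a ^ (-i'))) (a ^ i' * b ^ j') := by
      simp only [K, conjBy]
      group
    have e' : ∀ x y g : PresentedGroup metabelianRelators,
        conjBy x g * conjBy y g = conjBy (x * y) g := by
      intro x y g
      simp [conjBy, mul_assoc]
    dsimp only
    rw [e]
    change _ * conjBy c (a ^ i' * b ^ j') = conjBy c (a ^ i' * b ^ j') * _
    rw [e', e', h.eq]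
  refine isSolvable_of_commuting_set (closure_genA_genB _) X hX ?_ (hX₀ hc0)
  intro g hg x hx
  have hb' := fun n => hconjb n x (Subgroup.subset_closure hx)
  obtain ⟨⟨i, j⟩, rfl⟩ := hx
  rcases hg with rfl | rfl | rfl | rfl
  · simpa using hKa i j 1
  · simpa using hKa i j (-1)
  · simpa using hb' 1
  · simpa using hb' (-1)

theorem vanishOnAxes_zSquare : VanishOnAxes zSquareRelators := by
  rintro r rfl T _ t
  simp [letterA, letterB]

theorem vanishOnAxes_heisenberg : VanishOnAxes heisenbergRelators := by
  rintro r (rfl | rfl) T _ t <;> simp [letterA, letterB, commBy]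

theorem vanishOnAxes_wreath : VanishOnAxes wreathRelators := by
  rintro r ⟨i, j, rfl⟩ T _ t
  simp [letterA, letterB, commBy, conjBy]

theorem vanishOnAxes_metabelian : VanishOnAxes metabelianRelators := by
  rintro r ⟨i, j, rfl⟩ T _ t
  simp [letterA, letterB, commBy, conjBy]

/-! ### Finite models of solvable groups and soficity -/

open Classical in
/-- Abelian groups have Følner sets, because boxes in the generators grow polynomially. -/
theorem exists_folner {A : Type*} [CommGroup A] (S : Finset A) {ε : ℝ} (hε : 0 < ε) :
    ∃ F : Finset A, F.Nonempty ∧ ∀ s ∈ S, ((F.filter fun x => s * x ∉ F).card : ℝ) ≤ ε * F.card := by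
  let box : ℕ → Finset A := fun m =>
    (Fintype.piFinset fun _ : S => Finset.range m).image fun e => ∏ s : S, (s : A) ^ e s
  have hmem : ∀ m x, x ∈ box m ↔ ∃ e : S → ℕ, (∀ s, e s < m) ∧ ∏ s : S, (s : A) ^ e s = x := by
    intro m x
    simp [box, Fintype.mem_piFinset]
  have hcard : ∀ m, ((box m).card : ℝ) ≤ (m : ℝ) ^ S.card := by
    intro m
    have : (box m).card ≤ m ^ S.card := Finset.card_image_le.trans (by simp [Fintype.card_piFinset])
    exact_mod_cast this
  have hsub : ∀ m, box m ⊆ box (m + 1) := by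
    intro m x hx
    obtain ⟨e, he, rfl⟩ := (hmem m x).mp hx
    exact (hmem _ _).mpr ⟨e, fun s => (he s).trans (Nat.lt_succ_self m), rfl⟩
  have hmul : ∀ m, ∀ s ∈ S, ∀ x ∈ box m, s * x ∈ box (m + 1) := by
    intro m s hs x hx
    obtain ⟨e, he, rfl⟩ := (hmem m x).mp hx
    refine (hmem _ _).mpr ⟨e + Pi.single ⟨s, hs⟩ 1, fun t => ?_, ?_⟩
    · have h1 : (Pi.single ⟨s, hs⟩ 1 : S → ℕ) t ≤ 1 := by
        by_cases h : t = ⟨s, hs⟩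
        · subst h; simp
        · simp [h]
      have h2 := he t
      simp only [Pi.add_apply]
      omega
    · simp only [Pi.add_apply, pow_add, Finset.prod_mul_distrib]
      rw [mul_comm]
      congr 1
      rw [Finset.prod_eq_single ⟨s, hs⟩ (fun t _ ht => by simp [ht]) (by simp)]
      simp
  have hpos : ∀ m, 0 < m → (box m).Nonempty := fun m hm =>
    ⟨1, (hmem m 1).mpr ⟨0, fun _ => hm, by simp⟩⟩
  by_contra! hno
  -- If no box is a Følner set, every step enlarges the box by the factor 1 + ε, against the bound m
  -- ^ |S|.
  have hgrow : ∀ m, 0 < m → (1 + ε) * (box m).card ≤ (box (m + 1)).card := by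
    intro m hm
    obtain ⟨s, hs, h⟩ := hno (box m) (hpos m hm)
    have h1 : ((box m).filter fun x => s * x ∉ box m).card ≤ (box (m + 1) \ box m).card := by
      refine Finset.card_le_card_of_injOn (fun x => s * x) ?_ (fun x _ y _ h => mul_left_cancel h)
      intro x hx
      obtain ⟨hx, hx'⟩ := Finset.mem_filter.mp hx
      exact Finset.mem_sdiff.mpr ⟨hmul m s hs x hx, hx'⟩
    have h2 := Finset.card_sdiff_add_card_eq_card (hsub m)
    have h1' : (((box m).filter fun x => s * x ∉ box m).card : ℝ) ≤
        ((box (m + 1) \ box m).card : ℝ) := by exact_mod_cast h1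
    have h2' : ((box (m + 1) \ box m).card : ℝ) + (box m).card = (box (m + 1)).card := by
      exact_mod_cast h2
    linarith
  have hexp : ∀ m : ℕ, (1 + ε) ^ m ≤ ((box (m + 1)).card : ℝ) := by
    intro m
    induction m with
    | zero => simpa using hpos 1 one_pos
    | succ m ih =>
      rw [pow_succ']
      exact (mul_le_mul_of_nonneg_left ih (by linarith)).trans (hgrow (m + 1) m.succ_pos)
  have hlim := tendsto_pow_const_div_const_pow_of_one_lt S.card (show (1 : ℝ) < 1 + ε by linarith)
  have hev := (hlim.eventually (gt_mem_nhds (show (0 : ℝ) < 1 / (1 + ε) by positivity))).and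
    (Filter.eventually_ge_atTop 1)
  obtain ⟨m, hm, hm1⟩ := hev.exists
  obtain ⟨m, rfl⟩ := Nat.exists_eq_add_of_le' hm1
  have h1 : (1 + ε) ^ m ≤ ((m + 1 : ℕ) : ℝ) ^ S.card := (hexp m).trans (hcard _)
  rw [div_lt_div_iff₀ (by positivity) (by linarith), pow_succ] at hm
  have : ((m + 1 : ℕ) : ℝ) ^ S.card < (1 + ε) ^ m := by
    have h : (0 : ℝ) < 1 + ε := by linarith
    exact lt_of_mul_lt_mul_right (by linarith) h.le
  linarith

/-- Translation is a partial bijection of the finite set F, and any such extends to a permutation.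
-/
theorem exists_perm_eq_mul {A : Type*} [Group A] (F : Finset A) (a : A) :
    ∃ τ : Equiv.Perm F, ∀ (x : F), a * (x : A) ∈ F → (τ x : A) = a * x := by
  classical
  let e : {x : F // a * (x : A) ∈ F} ≃ {y : F // a⁻¹ * (y : A) ∈ F} :=
    { toFun := fun x => ⟨⟨a * x, x.2⟩, by simp⟩
      invFun := fun y => ⟨⟨a⁻¹ * y, y.2⟩, by simp⟩
      left_inv := fun x => by ext; simp
      right_inv := fun y => by ext; simp }
  exact ⟨e.extendSubtype, fun x hx => by rw [e.extendSubtype_apply_of_mem x hx]; rfl⟩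

theorem card_filter_prod_le {X Y : Type*} [Fintype X] [Fintype Y] (P : X × Y → Prop)
    (bad : X → Prop) [DecidablePred P] [DecidablePred bad] {a b : ℝ} (hb0 : 0 ≤ b)
    (ha : ((Finset.univ.filter bad).card : ℝ) ≤ a * Fintype.card X)
    (hb : ∀ x, ¬ bad x → ((Finset.univ.filter fun y => P (x, y)).card : ℝ) ≤ b * Fintype.card Y) :
    ((Finset.univ.filter P).card : ℝ) ≤ (a + b) * Fintype.card (X × Y) := by
  have h1 : ((Finset.univ.filter P).card : ℝ) =
      ∑ x, ((Finset.univ.filter fun y => P (x, y)).card : ℝ) := by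
    simp only [Finset.card_filter, Fintype.sum_prod_type]
    push_cast
    rfl
  have h2 : ∀ x, ((Finset.univ.filter fun y => P (x, y)).card : ℝ) ≤
      (if bad x then (1 : ℝ) else 0) * Fintype.card Y + b * Fintype.card Y := by
    intro x
    have hY : (0 : ℝ) ≤ Fintype.card Y := Nat.cast_nonneg _
    split_ifs with h
    · have : ((Finset.univ.filter fun y => P (x, y)).card : ℝ) ≤ Fintype.card Y := by
        exact_mod_cast Finset.card_le_univ _
      nlinarith
    · simpa using hb x h
  calc ((Finset.univ.filter P).card : ℝ)
      ≤ ∑ x, ((if bad x then (1 : ℝ) else 0) * Fintype.card Y + b * Fintype.card Y) := by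
        rw [h1]; exact Finset.sum_le_sum fun x _ => h2 x
    _ = ((Finset.univ.filter bad).card : ℝ) * Fintype.card Y +
          b * Fintype.card X * Fintype.card Y := by
        rw [Finset.sum_add_distrib, ← Finset.sum_mul, Finset.sum_const, Finset.sum_boole,
          Finset.card_univ, nsmul_eq_mul]
        ring
    _ ≤ a * Fintype.card X * Fintype.card Y + b * Fintype.card X * Fintype.card Y := by
        gcongr
    _ = _ := by rw [Fintype.card_prod]; push_cast; ring

open Classical in
/-- Approximability by permutations of finite nonempty types, in terms of the number of points
where multiplicativity or freeness fails. -/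
def HasFiniteModels (G : Type) [Group G] : Prop :=
  ∀ (S : Finset G) (δ : ℝ), 0 < δ → ∃ (X : Type) (_ : Fintype X) (_ : Nonempty X)
    (ψ : G → Equiv.Perm X),
    (∀ g ∈ S, ∀ h ∈ S, g * h ∈ S →
      ((Finset.univ.filter fun x => ψ g (ψ h x) ≠ ψ (g * h) x).card : ℝ) ≤ δ * Fintype.card X) ∧
    ∀ g ∈ S, g ≠ 1 → ((Finset.univ.filter fun x => ψ g x = x).card : ℝ) ≤ δ * Fintype.card X

theorem HasFiniteModels.isSofic {G : Type} [Group G] (hG : HasFiniteModels G) : IsSofic G := by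
  classical
  intro S δ hδ
  obtain ⟨X, _, _, ψ, h1, h2⟩ := hG S (δ / 2) (by linarith)
  let e := Fintype.equivFin X
  have hpos : (0 : ℝ) < Fintype.card X := by exact_mod_cast Fintype.card_pos
  have hcount : ∀ ρ σ : Equiv.Perm X, hammingDistance (e.permCongr ρ) (e.permCongr σ) =
      ((Finset.univ.filter fun x => ρ x ≠ σ x).card : ℝ) / Fintype.card X := by
    intro ρ σ
    rw [hammingDistance]
    congr 2
    refine Finset.card_nbij' e.symm e ?_ ?_ ?_ ?_ <;> intro x <;> simp
  refine ⟨Fintype.card X, Fintype.card_pos, fun g => e.permCongr (ψ g), ?_, ?_⟩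
  · intro g hg h hh hgh
    have hmul : e.permCongr (ψ g) * e.permCongr (ψ h) = e.permCongr (ψ g * ψ h) := by
      ext; simp
    rw [hmul, hcount, div_lt_iff₀ hpos]
    have := h1 g hg h hh hgh
    refine lt_of_le_of_lt (le_trans (le_of_eq ?_) this) (by nlinarith)
    simp only [Equiv.Perm.mul_apply]
    congr!
  · intro g hg hne
    have hone : (1 : Equiv.Perm (Fin (Fintype.card X))) = e.permCongr 1 := by ext; simp
    rw [hone, hcount, lt_div_iff₀ hpos]
    have h := h2 g hg hne
    have hsum : ((Finset.univ.filter fun x => ψ g x = x).card : ℝ) +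
        ((Finset.univ.filter fun x => ψ g x ≠ (1 : Equiv.Perm X) x).card : ℝ) =
          Fintype.card X := by
      have := Finset.card_filter_add_card_filter_not (s := (Finset.univ : Finset X))
        (fun x => ψ g x = x)
      rw [Finset.card_univ] at this
      exact_mod_cast this
    nlinarith

theorem hasFiniteModels_of_subsingleton {G : Type} [Group G] [Subsingleton G] :
    HasFiniteModels G := fun S δ hδ =>
  ⟨Unit, inferInstance, inferInstance, 1, by simp [hδ.le],
    fun g _ hg => absurd (Subsingleton.elim g 1) hg⟩

/-- An extension with finitely approximable kernel and abelian quotient is finitely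
approximable. -/
theorem HasFiniteModels.of_ker {G A : Type} [Group G] [CommGroup A] (f : G →* A)
    (hf : Function.Surjective f) (hN : HasFiniteModels f.ker) : HasFiniteModels G := by
  classical
  intro S δ hδ
  obtain ⟨F, hFne, hF⟩ := exists_folner (S.image f) (show 0 < δ / 3 by linarith)
  let σ := Function.surjInv hf
  have hσ : ∀ a, f (σ a) = a := Function.surjInv_eq hf
  -- The cocycle of the section σ: g moves the fibre over x to the fibre over f(g)x, and κ g x
  -- records this motion inside the kernel. The model of G is the skew product of the translations
  -- of F with the model of the kernel.
  let κ : G → A → f.ker := fun g x => ⟨(σ (f g * x))⁻¹ * g * σ x, by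
    rw [MonoidHom.mem_ker, map_mul, map_mul, map_inv, hσ, hσ, mul_assoc, inv_mul_cancel]⟩
  have hκ : ∀ g h x, κ g (f h * x) * κ h x = κ (g * h) x := by
    intro g h x
    ext
    simp [κ, mul_assoc]
  obtain ⟨Y, _, _, ψ, h1, h2⟩ := hN ((S ×ˢ F).image fun p => κ p.1 p.2) (δ / 3) (by linarith)
  have hκS : ∀ g ∈ S, ∀ x ∈ F, κ g x ∈ (S ×ˢ F).image fun p => κ p.1 p.2 := fun g hg x hx =>
    Finset.mem_image.mpr ⟨(g, x), Finset.mem_product.mpr ⟨hg, hx⟩, rfl⟩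
  choose τ hτ using fun g => exists_perm_eq_mul F (f g)
  have hbad : ∀ g ∈ S, ((Finset.univ.filter fun x : F => f g * (x : A) ∉ F).card : ℝ) ≤
      δ / 3 * Fintype.card F := by
    intro g hg
    have := hF (f g) (Finset.mem_image_of_mem f hg)
    rw [Fintype.card_coe]
    refine le_trans (le_of_eq ?_) this
    congr 1
    refine Finset.card_nbij (fun x => (x : A)) ?_ (fun x _ y _ h => Subtype.ext h) ?_
    · intro x hx
      simpa using hx
    · intro x hx
      obtain ⟨hx, hx'⟩ := Finset.mem_filter.mp hx
      exact ⟨⟨x, hx⟩, by simpa using hx', rfl⟩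
  have : Nonempty F := hFne.to_subtype
  refine ⟨F × Y, inferInstance, inferInstance,
    fun g => Equiv.prodShear (τ g) fun x => ψ (κ g x), ?_, ?_⟩
  · intro g hg h hh hgh
    have := card_filter_prod_le (X := F) (Y := Y)
      (fun p => Equiv.prodShear (τ g) (fun x => ψ (κ g x))
        (Equiv.prodShear (τ h) (fun x => ψ (κ h x)) p) ≠
          Equiv.prodShear (τ (g * h)) (fun x => ψ (κ (g * h) x)) p)
      -- Outside this set, of proportion at most 2δ/3, the base permutations compose exactly and the
      -- cocycle identity applies; the fibre model contributes the last δ/3.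
      (fun x => f h * (x : A) ∉ F ∨ f (g * h) * (x : A) ∉ F) (a := δ / 3 + δ / 3) (b := δ / 3)
      (by linarith) ?_ ?_
    · refine le_trans (le_of_eq ?_) (this.trans (le_of_eq (by ring)))
      congr!
    · rw [Finset.filter_or, add_mul]
      have hle : (((Finset.univ.filter fun x : F => f h * (x : A) ∉ F) ∪
          (Finset.univ.filter fun x : F => f (g * h) * (x : A) ∉ F)).card : ℝ) ≤
          ((Finset.univ.filter fun x : F => f h * (x : A) ∉ F).card : ℝ) +
          ((Finset.univ.filter fun x : F => f (g * h) * (x : A) ∉ F).card : ℝ) := by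
        exact_mod_cast Finset.card_union_le _ _
      linarith [hbad h hh, hbad (g * h) hgh]
    · intro x hx
      push Not at hx
      obtain ⟨hx1, hx2⟩ := hx
      have e1 : (τ h x : A) = f h * x := hτ h x hx1
      have e2 : (τ (g * h) x : A) = f (g * h) * x := hτ (g * h) x hx2
      have e12 : f g * (τ h x : A) = f (g * h) * x := by rw [e1, map_mul, mul_assoc]
      have e3 : τ g (τ h x) = τ (g * h) x := by
        ext
        rw [hτ g _ (by rw [e12]; exact hx2), e12, e2]
      have hm := hκ g h x
      rw [← e1] at hm
      have := h1 (κ g (τ h x)) (hκS g hg _ (τ h x).2) (κ h x) (hκS h hh _ x.2)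
        (by rw [hm]; exact hκS _ hgh _ x.2)
      rw [hm] at this
      refine le_trans (le_of_eq ?_) this
      congr 2
      ext y
      simp [e3]
  · intro g hg hne
    have := card_filter_prod_le (X := F) (Y := Y)
      (fun p => Equiv.prodShear (τ g) (fun x => ψ (κ g x)) p = p)
      (fun x => f g * (x : A) ∉ F) (a := δ / 3) (b := δ / 3) (by linarith) (hbad g hg) ?_
    · refine le_trans (le_of_eq ?_) (this.trans ?_)
      · congr!
      · gcongr
        linarith
    · intro x hx
      rw [not_not] at hx
      have hδY : 0 ≤ δ / 3 * (Fintype.card Y : ℝ) := by positivity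
      -- If f(g) = 1, then κ g x is a conjugate of g, so the fibre model bounds its fixed points.
      -- Otherwise the base point itself moves.
      by_cases hfg : f g = 1
      · have hκ1 : κ g x ≠ 1 := by
          intro h
          have h' : (σ (f g * x))⁻¹ * g * σ x = 1 := congrArg Subtype.val h
          rw [hfg, one_mul, mul_assoc, inv_mul_eq_one, right_eq_mul] at h'
          exact hne h'
        refine le_trans ?_ (h2 _ (hκS g hg _ x.2) hκ1)
        norm_cast
        refine Finset.card_le_card fun y hy => ?_
        rw [Finset.mem_filter] at hy ⊢
        exact ⟨hy.1, congrArg Prod.snd hy.2⟩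
      · rw [Finset.filter_false_of_mem]
        · simpa using hδY
        · intro y _ h
          have h' : (τ g x : A) = x := congrArg (fun p => ((p.1 : F) : A)) h
          rw [hτ g x hx, mul_eq_right] at h'
          exact hfg h'

theorem hasFiniteModels_of_isSolvable {G : Type} [Group G] (hG : Group.IsSolvable G) :
    HasFiniteModels G := by
  obtain ⟨n, hn⟩ := (Group.isSolvable_def G).mp hG
  clear hG
  induction n generalizing G with
  | zero =>
    have : Subsingleton G := by
      rw [derivedSeries_zero] at hn
      exact Subgroup.subsingleton_iff.mp (subsingleton_of_bot_eq_top hn.symm)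
    exact hasFiniteModels_of_subsingleton
  | succ n ih =>
    refine HasFiniteModels.of_ker (Abelianization.of (G := G)) QuotientGroup.mk_surjective (ih ?_)
    -- The kernel is the commutator subgroup, so its derived series is that of G shifted by one, and
    -- its derived length drops.
    have hmap : ∀ m, (derivedSeries (Abelianization.of (G := G)).ker m).map
        (Abelianization.of (G := G)).ker.subtype = derivedSeries G (m + 1) := by
      intro m
      induction m with
      | zero =>
        rw [derivedSeries_zero, ← MonoidHom.range_eq_map, Subgroup.range_subtype,
          Abelianization.ker_of]
        rfl
      | succ m ihm =>
        rw [derivedSeries_succ, Subgroup.map_commutator, ihm, ← derivedSeries_succ]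
    have := hmap n
    rw [hn] at this
    exact (Subgroup.map_eq_bot_iff_of_injective _ (Subgroup.subtype_injective _)).mp this

/-- Solvable groups are closed under finite products, so the separating maps for the elements of S
combine into one. -/
theorem IsResiduallySolvable.exists_hom_ne_one {Γ : Type} [Group Γ] (h : IsResiduallySolvable Γ)
    (S : Finset Γ) : ∃ (T : Type) (_ : Group T) (f : Γ →* T), Group.IsSolvable T ∧
      ∀ g ∈ S, g ≠ 1 → f g ≠ 1 := by
  classical
  induction S using Finset.induction_on with
  | empty => exact ⟨Unit, inferInstance, 1, inferInstance, by simp⟩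
  | insert x S _ ih =>
    obtain ⟨T, _, f, hT, hf⟩ := ih
    by_cases hx : x = 1
    · refine ⟨T, _, f, hT, fun g hg hg1 => ?_⟩
      rcases Finset.mem_insert.mp hg with rfl | hg
      · exact absurd hx hg1
      · exact hf g hg hg1
    · obtain ⟨T', _, f', -, hT', hf'⟩ := h x hx
      refine ⟨T' × T, inferInstance, f'.prod f, inferInstance, fun g hg hg1 e => ?_⟩
      rcases Finset.mem_insert.mp hg with rfl | hg
      · exact hf' (congrArg Prod.fst e)
      · exact hf g hg hg1 (congrArg Prod.snd e)

theorem IsResiduallySolvable.isSofic {Γ : Type} [Group Γ] (h : IsResiduallySolvable Γ) :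
    IsSofic Γ := by
  classical
  refine HasFiniteModels.isSofic fun S δ hδ => ?_
  obtain ⟨T, _, f, hT, hf⟩ := h.exists_hom_ne_one S
  obtain ⟨X, _, _, ψ, h1, h2⟩ := hasFiniteModels_of_isSolvable hT (S.image f) δ hδ
  refine ⟨X, inferInstance, inferInstance, fun g => ψ (f g), ?_, ?_⟩
  · intro g hg h hh hgh
    have := h1 (f g) (Finset.mem_image_of_mem f hg) (f h) (Finset.mem_image_of_mem f hh)
      (by rw [← map_mul]; exact Finset.mem_image_of_mem f hgh)
    rw [← map_mul] at this
    convert this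
  · intro g hg hne
    convert h2 (f g) (Finset.mem_image_of_mem f hg) (hf g hg hne)

theorem isResiduallySolvable_and_isSofic_higBarCyclic {k : ℕ} (hk : 4 ≤ k)
    {R : Set (FreeGroup (Fin 2))} (hR : VanishOnAxes R)
    (hG : Group.IsSolvable (PresentedGroup R)) (h : orderOf (genA R) = orderOf (genB R)) :
    IsResiduallySolvable (HigBarCyclic k (genA R) (genB R) h) ∧
      IsSofic (HigBarCyclic k (genA R) (genB R) h) :=
  have := isResiduallySolvable_higBarCyclic hk hR hG h
  ⟨this, this.isSofic⟩

end HigmanVariations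

theorem corollary4p6 (k : ℕ) (hk : 4 ≤ k) :
    (HigmanVariations.IsResiduallySolvable (HigmanVariations.HigBarZSquare k) ∧
      HigmanVariations.IsSofic (HigmanVariations.HigBarZSquare k)) ∧
    (HigmanVariations.IsResiduallySolvable (HigmanVariations.HigBarHeisenberg k) ∧
      HigmanVariations.IsSofic (HigmanVariations.HigBarHeisenberg k)) ∧
    (HigmanVariations.IsResiduallySolvable (HigmanVariations.HigBarWreath k) ∧
      HigmanVariations.IsSofic (HigmanVariations.HigBarWreath k)) ∧
    (HigmanVariations.IsResiduallySolvable (HigmanVariations.HigBarMetabelian k) ∧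
      HigmanVariations.IsSofic (HigmanVariations.HigBarMetabelian k)) :=
  ⟨HigmanVariations.isResiduallySolvable_and_isSofic_higBarCyclic hk
      HigmanVariations.vanishOnAxes_zSquare HigmanVariations.isSolvable_zSquare _,
    HigmanVariations.isResiduallySolvable_and_isSofic_higBarCyclic hk
      HigmanVariations.vanishOnAxes_heisenberg HigmanVariations.isSolvable_heisenberg _,
    HigmanVariations.isResiduallySolvable_and_isSofic_higBarCyclic hk
      HigmanVariations.vanishOnAxes_wreath HigmanVariations.isSolvable_wreathRelators _,
    HigmanVariations.isResiduallySolvable_and_isSofic_higBarCyclic hk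
      HigmanVariations.vanishOnAxes_metabelian HigmanVariations.isSolvable_metabelian _⟩
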